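/- Fix $m>0$. On $\mathbb{R}^4\cong\mathbb{C}^2$ with coordinates $(z_1,z_2)$, let $r^2=|z_1|^2+|z_2|^2$, let $\mathbf{e}$ be the euclidean metric, and let $I_1(z_1,z_2)=(iz_1,iz_2)$, $I_2(z_1,z_2)=(-\overline{z_2},\overline{z_1})$, $I_3=I_1I_2$ be the standard complex structures. Let $u,v\ge 0$ be the functions determined by $|z_1|=e^{m(u^2-v^2)}u$, $|z_2|=e^{m(v^2-u^2)}v$, and put $y_1=\tfrac12(u^2-v^2)$, $y_2+iy_3=-iz_1z_2$, $R=\tfrac12(u^2+v^2)=(y_1^2+y_2^2+y_3^2)^{1/2}$, $V=\frac{1+4mR}{2R}$, $\eta=V\,I_1dy_1$. The Taub-NUT metric is $\mathbf{f}=V(dy_1^2+dy_2^2+dy_3^2)+V^{-1}\eta^2$. A field of endomorphisms $J$ acts on 1-forms by $J\alpha=-\alpha(J\,\cdot)$, and $dd^c_J\psi:=d(J\,d\psi)$. Let $\theta_j=\frac14 dd^c_{I_j}(r^{-2})$ for $j=2,3$. Let $k\ge2$, let $\mathcal{D}_k\subset \mathrm{SU}(2)$ be the binary dihedral group of order $4k$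 generated by $\mathrm{diag}(e^{i\pi/k},e^{-i\pi/k})$ and $\begin{pmatrix}0&-1\\1&0\end{pmatrix}$, and let $(Y,g_Y,I_1^Y,I_2^Y,I_3^Y)$ be an ALE gravitational instanton modelled on $\mathbb{R}^4/\mathcal{D}_k$: a hyperkähler 4-manifold with a diffeomorphism $\Phi_Y$ from the complement of a compact subset of $Y$ onto $(\mathbb{R}^4\setminus B)/\mathcal{D}_k$, with $B$ a ball centred at the origin, such that $|(\nabla^{\mathbf{e}})^\ell(\Phi_{Y*}g_Y-\mathbf{e})|_{\mathbf{e}}$ and $|(\nabla^{\mathbf{e}})^\ell(\Phi_{Y*}I_j^Y-I_j)|_{\mathbf{e}}$ ($j=1,2,3$) are $O(r^{-4-\ell})$ for all $\ell\ge0$. Write again $I_1^Y$ for $\Phi_{Y*}I_1^Y$, lifted to $\mathbb{R}^4\setminus B$. Consider the complex valued function $$\psi_c:=-\frac14\,\frac{(y_2+iy_3)\sinh(4my_1)}{r^2R}\qquad\text{on }\mathbb{R}^4\setminus\{0\}.$$ Then near infinity: 1. $|(\nabla^{\mathbf{f}})^\ell\psi_c|_{\mathbf{f}}=O(R^{-1})$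 for $\ell=0,\dots,4$; 2. $|(\nabla^{\mathbf{f}})^\ell(dd^c_{I_1}\psi_c-(\theta_2+i\theta_3))|_{\mathbf{f}}=O(R^{-2})$ for $\ell=0,1,2$, and likewise $|(\nabla^{\mathbf{f}})^\ell(dd^c_{I_1^Y}\psi_c-(\theta_2+i\theta_3))|_{\mathbf{f}}=O(R^{-2})$ for $\ell=0,1,2$. -/

import Mathlib

open scoped Manifold ContDiff

noncomputable section

namespace TaubNUT

/-- `ℂ² = ℝ⁴` with its euclidean norm `r = ‖z‖`; `z 0` and `z 1` are the complex coordinates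
`z₁` and `z₂`. -/
abbrev C2 : Type := EuclideanSpace ℂ (Fin 2)

/-! ### The standard complex structures of `ℝ⁴ = ℍ` -/

/-- `I₁ (z₁, z₂) = (i z₁, i z₂)`. -/
def stdI₁ : C2 →L[ℝ] C2 :=
  LinearMap.toContinuousLinearMap
    { toFun := fun z => !₂[Complex.I * z 0, Complex.I * z 1]
      map_add' := by
        intro x y; ext i; fin_cases i <;> simp [mul_add]
      map_smul' := by
        intro c x; ext i; fin_cases i <;> (simp; ring) }

/-- `I₂ (z₁, z₂) = (-conj z₂, conj z₁)`. -/
def stdI₂ : C2 →L[ℝ] C2 :=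
  LinearMap.toContinuousLinearMap
    { toFun := fun z => !₂[-(starRingEnd ℂ (z 1)), starRingEnd ℂ (z 0)]
      map_add' := by
        intro x y; ext i; fin_cases i <;> simp <;> ring
      map_smul' := by
        intro c x; ext i; fin_cases i <;> simp }

/-- The standard triple `I₁`, `I₂`, `I₃ = I₁ I₂`, indexed by `0, 1, 2`. -/
def stdI : Fin 3 → C2 →L[ℝ] C2 := ![stdI₁, stdI₂, stdI₁.comp stdI₂]

/-- The euclidean metric of `ℂ² = ℝ⁴`. -/
def euclid : C2 →L[ℝ] C2 →L[ℝ] ℝ := innerSL ℝ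

theorem euclid_apply (X Z : C2) : euclid X Z = inner ℝ X Z := rfl

/-! ### Tensor calculus for a metric on `ℝ⁴` -/

/-- Complex valued covariant `k`-tensor fields on `ℝ⁴`. -/
abbrev CTensor (k : ℕ) : Type := C2 → (Fin k → C2) → ℂ

/-- A function seen as a `0`-tensor. -/
def scalar (ψ : C2 → ℂ) : CTensor 0 := fun z _ => ψ z

/-- `e` is an orthonormal frame for the bilinear form `b`. -/
def IsOrthonormalFrame (b : C2 → C2 → ℝ) (e : Fin 4 → C2) : Prop :=
  ∀ i j, b (e i) (e j) = if i = j then 1 else 0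

/-- A choice of orthonormal frame; the notions defined through it below do not depend on this
choice. -/
def orthoFrame (b : C2 → C2 → ℝ) : Fin 4 → C2 :=
  Classical.epsilon (IsOrthonormalFrame b)

/-- The Christoffel term `Γ_z(X, Y) = ∇_X Y - D_X Y` (for `Y` constant) of the Levi-Civita
connection of `g`, given by the Koszul formula
`2 g(Γ(X, Y), Z) = D_X g(Y, Z) + D_Y g(X, Z) - D_Z g(X, Y)`. -/
def christoffel (g : C2 → C2 → C2 → ℝ) (z X Y : C2) : C2 :=
  ∑ a : Fin 4,
    ((fderiv ℝ (fun w => g w Y (orthoFrame (g z) a)) z X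
      + fderiv ℝ (fun w => g w X (orthoFrame (g z) a)) z Y
      - fderiv ℝ (fun w => g w X Y) z (orthoFrame (g z) a)) / 2) • orthoFrame (g z) a

/-- Levi-Civita covariant derivative of a covariant tensor field; the new slot comes first. -/
def covDeriv (g : C2 → C2 → C2 → ℝ) {k : ℕ} (T : CTensor k) : CTensor (k + 1) :=
  fun z X =>
    fderiv ℝ (fun w => T w (Fin.tail X)) z (X 0)
      - ∑ i : Fin k,
          T z (Function.update (Fin.tail X) i (christoffel g z (X 0) (X i.succ)))

/-- The iterated covariant derivative `∇^ℓ T`. -/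
def iterCovDeriv (g : C2 → C2 → C2 → ℝ) {k : ℕ} : (ℓ : ℕ) → CTensor k → CTensor (k + ℓ)
  | 0, T => T
  | ℓ + 1, T => covDeriv g (iterCovDeriv g ℓ T)

/-- The pointwise norm `|T|_g` of a covariant tensor field. -/
def tensorNorm (g : C2 → C2 → C2 → ℝ) {k : ℕ} (T : CTensor k) (z : C2) : ℝ :=
  Real.sqrt (∑ i : Fin k → Fin 4, ‖T z (fun a => orthoFrame (g z) (i a))‖ ^ 2)

/-- The `J`-complex Hessian `d d^c_J ψ = d (J dψ)`, a 2-form, where `J` acts on 1-forms by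
`J α = -α(J ·)`. -/
def ddc (J : C2 → C2 →L[ℝ] C2) (ψ : C2 → ℂ) : CTensor 2 :=
  fun z X =>
    fderiv ℝ (fun w => -(fderiv ℝ ψ w (J w (X 1)))) z (X 0)
      - fderiv ℝ (fun w => -(fderiv ℝ ψ w (J w (X 0)))) z (X 1)

/-- `θ_j = (1/4) d d^c_{I_j} (r⁻²)`. -/
def theta (j : Fin 3) : CTensor 2 :=
  fun z X => (1 / 4 : ℂ) * ddc (fun _ => stdI j) (fun w => (((‖w‖ ^ 2)⁻¹ : ℝ) : ℂ)) z X

/-- The complex 2-form `θ₂ + i θ₃`. -/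
def thetaC : CTensor 2 := fun z X => theta 1 z X + Complex.I * theta 2 z X

/-! ### The Taub-NUT metric -/

/-- The equations `|z₁| = e^{m(u²-v²)} u`, `|z₂| = e^{m(v²-u²)} v` with `u, v ≥ 0`. -/
def IsUV (m : ℝ) (z : C2) (p : ℝ × ℝ) : Prop :=
  0 ≤ p.1 ∧ 0 ≤ p.2 ∧
    ‖z 0‖ = Real.exp (m * (p.1 ^ 2 - p.2 ^ 2)) * p.1 ∧
    ‖z 1‖ = Real.exp (m * (p.2 ^ 2 - p.1 ^ 2)) * p.2

theorem existsUnique_isUV {m : ℝ} (hm : 0 < m) (z : C2) : ∃! p : ℝ × ℝ, IsUV m z p := by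
  set a := ‖z 0‖ with ha
  set b := ‖z 1‖ with hb
  have ha0 : 0 ≤ a := norm_nonneg _
  have hb0 : 0 ≤ b := norm_nonneg _
  let F : ℝ → ℝ := fun t => t - (a * Real.exp (-(m * t))) ^ 2 + (b * Real.exp (m * t)) ^ 2
  have hF : StrictMono F := by
    intro s t hst
    have h1 : Real.exp (-(m * t)) ≤ Real.exp (-(m * s)) := Real.exp_le_exp.2 (by nlinarith)
    have h2 : Real.exp (m * s) ≤ Real.exp (m * t) := Real.exp_le_exp.2 (by nlinarith)
    have h3 : (a * Real.exp (-(m * t))) ^ 2 ≤ (a * Real.exp (-(m * s))) ^ 2 := by gcongr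
    have h4 : (b * Real.exp (m * s)) ^ 2 ≤ (b * Real.exp (m * t)) ^ 2 := by gcongr
    simp only [F]; linarith
  have hFc : Continuous F := by fun_prop
  have hlo : F (-b ^ 2) ≤ 0 := by
    have h2 : Real.exp (m * -b ^ 2) ≤ 1 := Real.exp_le_one_iff.2 (by nlinarith [sq_nonneg b])
    have h4 : (b * Real.exp (m * -b ^ 2)) ^ 2 ≤ (b * 1) ^ 2 := by gcongr
    simp only [F]; nlinarith [sq_nonneg (a * Real.exp (-(m * -b ^ 2)))]
  have hhi : 0 ≤ F (a ^ 2) := by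
    have h2 : Real.exp (-(m * a ^ 2)) ≤ 1 := Real.exp_le_one_iff.2 (by nlinarith [sq_nonneg a])
    have h4 : (a * Real.exp (-(m * a ^ 2))) ^ 2 ≤ (a * 1) ^ 2 := by gcongr
    simp only [F]; nlinarith [sq_nonneg (b * Real.exp (m * a ^ 2))]
  have hle : -b ^ 2 ≤ a ^ 2 := by nlinarith [sq_nonneg a, sq_nonneg b]
  obtain ⟨t, -, ht⟩ := intermediate_value_Icc hle hFc.continuousOn ⟨hlo, hhi⟩
  have key : (a * Real.exp (-(m * t))) ^ 2 - (b * Real.exp (m * t)) ^ 2 = t := by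
    simp only [F] at ht; linarith
  refine ⟨(a * Real.exp (-(m * t)), b * Real.exp (m * t)), ?_, ?_⟩
  · refine ⟨by positivity, by positivity, ?_, ?_⟩
    · simp only
      rw [key, ← ha, mul_comm a, ← mul_assoc, ← Real.exp_add]; simp
    · simp only
      rw [← neg_sub, key, ← hb, mul_comm b, ← mul_assoc, ← Real.exp_add]; simp
  · rintro ⟨u, v⟩ ⟨-, -, h1, h2⟩
    simp only at h1 h2
    rw [← ha] at h1
    rw [← hb] at h2
    have hu : u = a * Real.exp (-(m * (u ^ 2 - v ^ 2))) := by
      rw [h1, mul_comm (Real.exp _) u, mul_assoc, ← Real.exp_add]; simp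
    have hv : v = b * Real.exp (m * (u ^ 2 - v ^ 2)) := by
      rw [h2, mul_comm (Real.exp _) v, mul_assoc, ← Real.exp_add]
      rw [show m * (v ^ 2 - u ^ 2) + m * (u ^ 2 - v ^ 2) = 0 by ring]; simp
    have hFt : F (u ^ 2 - v ^ 2) = F t := by
      rw [ht]; simp only [F]; rw [← hu, ← hv]; ring
    have htt := hF.injective hFt
    rw [htt] at hu hv
    rw [← hu, ← hv]

/-- The pair `(u, v)` of functions on `ℂ²` (see `existsUnique_isUV`). -/
def uv (m : ℝ) (z : C2) : ℝ × ℝ := Classical.epsilon (IsUV m z)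

theorem isUV_uv {m : ℝ} (hm : 0 < m) (z : C2) : IsUV m z (uv m z) :=
  Classical.epsilon_spec (existsUnique_isUV hm z).exists

/-- `y₁ = (u² - v²) / 2`. -/
def y₁ (m : ℝ) (z : C2) : ℝ := ((uv m z).1 ^ 2 - (uv m z).2 ^ 2) / 2

/-- `y₂ + i y₃ = -i z₁ z₂`. -/
def yC (z : C2) : ℂ := -Complex.I * (z 0 * z 1)

/-- The three functions `y₁, y₂, y₃`, indexed by `0, 1, 2`. -/
def y (m : ℝ) : Fin 3 → C2 → ℝ := ![y₁ m, fun z => (yC z).re, fun z => (yC z).im]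

/-- `R = (u² + v²) / 2`. -/
def R (m : ℝ) (z : C2) : ℝ := ((uv m z).1 ^ 2 + (uv m z).2 ^ 2) / 2

/-- `V = (1 + 4mR) / (2R)`. -/
def V (m : ℝ) (z : C2) : ℝ := (1 + 4 * m * R m z) / (2 * R m z)

/-- The 1-form `η = V I₁ dy₁ = -V dy₁(I₁ ·)`. -/
def eta (m : ℝ) (z X : C2) : ℝ := -(V m z * fderiv ℝ (y₁ m) z (stdI 0 X))

/-- The Taub-NUT metric `f = V (dy₁² + dy₂² + dy₃²) + V⁻¹ η²` on `ℂ² ∖ {0}`. -/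
def metric (m : ℝ) (z X Y : C2) : ℝ :=
  V m z * ∑ j : Fin 3, fderiv ℝ (y m j) z X * fderiv ℝ (y m j) z Y
    + (V m z)⁻¹ * (eta m z X * eta m z Y)

/-- `ψ_c = -(1/4) (y₂ + i y₃) sinh(4 m y₁) / (r² R)`. -/
def psiC (m : ℝ) (z : C2) : ℂ :=
  -(1 / 4) * (yC z * (Real.sinh (4 * m * y₁ m z) : ℂ)) / ((‖z‖ ^ 2 * R m z : ℝ) : ℂ)

/-! ### ALE gravitational instantons of dihedral type -/

/-- The binary dihedral group of order `4k`, generated by `diag(e^{iπ/k}, e^{-iπ/k})` and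
`(0 -1; 1 0)`. Both generators have finite order, so the submonoid they generate is a group. -/
def binaryDihedral (k : ℕ) : Submonoid (Matrix (Fin 2) (Fin 2) ℂ) :=
  Submonoid.closure
    {!![Complex.exp (Complex.I * (Real.pi / k : ℝ)), 0;
        0, Complex.exp (-(Complex.I * (Real.pi / k : ℝ)))],
     !![0, -1; 1, 0]}

variable (Y : Type*) [TopologicalSpace Y] [ChartedSpace C2 Y] [IsManifold 𝓘(ℝ, C2) ∞ Y]

/-- `dω = 0` for a 2-form `ω` on `Y`, written in the charts of `Y`: with `ω` read in a chart,
`D_A ω(B, C) + D_B ω(C, A) + D_C ω(A, B) = 0` for all constant vectors. -/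
def IsClosedForm
    (form : (p : Y) → TangentSpace 𝓘(ℝ, C2) p → TangentSpace 𝓘(ℝ, C2) p → ℝ) : Prop :=
  ∀ p : Y, ∀ x ∈ (extChartAt 𝓘(ℝ, C2) p).target, ∀ A B C : C2,
    let c : C2 → Y := (extChartAt 𝓘(ℝ, C2) p).symm
    let ωc : C2 → C2 → C2 → ℝ := fun w A B =>
      form (c w) (mfderiv 𝓘(ℝ, C2) 𝓘(ℝ, C2) c w A) (mfderiv 𝓘(ℝ, C2) 𝓘(ℝ, C2) c w B)
    fderiv ℝ (fun w => ωc w B C) x A + fderiv ℝ (fun w => ωc w C A) x B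
      + fderiv ℝ (fun w => ωc w A B) x C = 0

/-- A smooth hyperkähler structure on a 4-manifold: a Riemannian metric `g` and three almost
complex structures which satisfy the quaternionic relations, are `g`-orthogonal, and whose
forms `ω_j = g(I_j ·, ·)` are closed (closedness of the three forms gives the integrability of
the `I_j`). -/
structure Hyperkahler where
  g : Bundle.ContMDiffRiemannianMetric 𝓘(ℝ, C2) ∞ C2 (fun p : Y => TangentSpace 𝓘(ℝ, C2) p)
  cs : Fin 3 → (p : Y) → TangentSpace 𝓘(ℝ, C2) p →L[ℝ] TangentSpace 𝓘(ℝ, C2) p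
  cs_smooth : ∀ j, ContMDiff 𝓘(ℝ, C2) (𝓘(ℝ, C2).prod 𝓘(ℝ, C2 →L[ℝ] C2)) ∞
    (fun p : Y => Bundle.TotalSpace.mk' (C2 →L[ℝ] C2)
      (E := fun p : Y => TangentSpace 𝓘(ℝ, C2) p →L[ℝ] TangentSpace 𝓘(ℝ, C2) p) p (cs j p))
  cs_sq : ∀ j p X, cs j p (cs j p X) = -X
  cs_mul : ∀ p X, cs 0 p (cs 1 p X) = cs 2 p X
  cs_orth : ∀ j p X Z, g.inner p (cs j p X) (cs j p Z) = g.inner p X Z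
  closed : ∀ j, IsClosedForm Y (fun p A B => g.inner p (cs j p A) B)

variable {Y}

/-- The pull-back `(dq)⁻¹ ∘ J ∘ dq` of a field of endomorphisms by a local diffeomorphism. -/
def pullEnd (q : C2 → Y)
    (J : (p : Y) → TangentSpace 𝓘(ℝ, C2) p →L[ℝ] TangentSpace 𝓘(ℝ, C2) p) (z : C2) :
    C2 →L[ℝ] C2 :=
  let D : C2 →L[ℝ] TangentSpace 𝓘(ℝ, C2) (q z) := mfderiv 𝓘(ℝ, C2) 𝓘(ℝ, C2) q z
  (D.inverse.comp (J (q z))).comp D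

/-- The pull-back of a field of bilinear forms. -/
def pullForm (q : C2 → Y)
    (h : (p : Y) → TangentSpace 𝓘(ℝ, C2) p →L[ℝ] TangentSpace 𝓘(ℝ, C2) p →L[ℝ] ℝ) (z : C2) :
    C2 →L[ℝ] C2 →L[ℝ] ℝ :=
  let D : C2 →L[ℝ] C2 := mfderiv 𝓘(ℝ, C2) 𝓘(ℝ, C2) q z
  let H : C2 →L[ℝ] C2 →L[ℝ] ℝ := h (q z)
  H.bilinearComp D D

/-- An ALE diffeomorphism `Φ` from the complement of a compact subset of `Y` onto
`(ℝ⁴ ∖ B) / 𝒟_k`, where `B` is the closed ball of radius `ρ`. It is given by the covering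
`q = Φ⁻¹ ∘ (ℝ⁴ ∖ B → (ℝ⁴ ∖ B) / 𝒟_k)`; the values of `q` on `B` play no role. Tensors of `Y`
are transported to `ℝ⁴ ∖ B` by `q`. -/
structure ALEEnd (k : ℕ) (S : Hyperkahler Y) where
  ρ : ℝ
  ρ_pos : 0 < ρ
  q : C2 → Y
  localDiffeo : IsLocalDiffeomorphOn 𝓘(ℝ, C2) 𝓘(ℝ, C2) ∞ q {z | ρ < ‖z‖}
  fibres : ∀ z w : C2, ρ < ‖z‖ → ρ < ‖w‖ →
    (q z = q w ↔ ∃ γ ∈ binaryDihedral k, w = WithLp.toLp 2 (γ.mulVec z))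
  compact : ∀ ρ', ρ ≤ ρ' → IsCompact (q '' {z | ρ' < ‖z‖})ᶜ
  metric_decay : ∀ ℓ : ℕ,
    (fun z => ‖iteratedFDeriv ℝ ℓ (fun w => pullForm q S.g.inner w - euclid) z‖)
      =O[Bornology.cobounded C2] fun z => (‖z‖ ^ (4 + ℓ))⁻¹
  cs_decay : ∀ (j : Fin 3) (ℓ : ℕ),
    (fun z => ‖iteratedFDeriv ℝ ℓ (fun w => pullEnd q (S.cs j) w - stdI j) z‖)
      =O[Bornology.cobounded C2] fun z => (‖z‖ ^ (4 + ℓ))⁻¹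

end TaubNUT

end

/-!
Write `y_ℂ = y₂ + i y₃`. The frame `N = (z₁, -z₂)`, `I₁ N`, `X`, `I₁ X` is dual to the real and
imaginary parts of `α = V dy₁ + i η` and `β = dy₂ + i dy₃`, and in it the metric `f` is diagonal
with entries `V⁻¹`, `V⁻¹`, `V`, `V`. The functions `1 / R`, `y / R`, `2 R / r²` and
`2 R sinh (4 m y₁) / r²` keep their order of decay when differentiated along this frame, and so do
the structure functions of the coframe; hence covariant derivatives for `f` do not lose decay.
The function `ψ_c` is chosen so that `-dψ_c ∘ I₁ - i dψ_c` is, up to `O(R⁻²)`, a primitive of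
`θ₂ + i θ₃`. Replacing `I₁` by a complex structure that is `O(r⁻⁴)`-close to it changes this form by
`O(R⁻²)` only, because `2 R ≤ r²`.
-/

noncomputable section

namespace TaubNUT

open Asymptotics Bornology Filter Topology

/-! ### Symbol classes at infinity -/

theorem eventually_cobounded_eventually_nhds {E : Type*} [NormedAddCommGroup E]
    {p : E → Prop} (h : ∀ᶠ z in cobounded E, p z) :
    ∀ᶠ z in cobounded E, ∀ᶠ w in 𝓝 z, p w := by
  obtain ⟨r, -, hr⟩ := (hasBasis_cobounded_norm (E := E)).eventually_iff.1 h
  filter_upwards [(hasBasis_cobounded_norm (E := E)).mem_of_mem (i := r + 1) trivial] with z hz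
  have hrz : r < ‖z‖ := (lt_add_one r).trans_le hz
  filter_upwards [(isOpen_lt continuous_const continuous_norm).mem_nhds hrz] with w hw
  exact hr hw.le

theorem isBigO_bilin {α F G H : Type*} [NormedAddCommGroup F] [NormedSpace ℝ F]
    [NormedAddCommGroup G] [NormedSpace ℝ G] [NormedAddCommGroup H] [NormedSpace ℝ H]
    {l : Filter α} (L : F →L[ℝ] G →L[ℝ] H) {f : α → F} {g : α → G} {w₁ w₂ : α → ℝ}
    (hf : f =O[l] w₁) (hg : g =O[l] w₂) : (fun z => L (f z) (g z)) =O[l] fun z => w₁ z * w₂ z := by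
  refine IsBigO.trans (.of_bound ‖L‖ (.of_forall fun z => ?_)) (hf.norm_left.mul hg.norm_left)
  simpa [mul_assoc] using L.le_opNorm₂ (f z) (g z)

section Symbols

variable {ι E F G H : Type*} [NormedAddCommGroup E] [NormedSpace ℝ E]
  [NormedAddCommGroup F] [NormedSpace ℝ F] [NormedAddCommGroup G] [NormedSpace ℝ G]
  [NormedAddCommGroup H] [NormedSpace ℝ H]

/-- Smoothness on a neighbourhood of infinity. -/
def SmoothAtInfinity (f : E → F) : Prop := ∀ᶠ z in cobounded E, ContDiffAt ℝ ∞ f z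

namespace SmoothAtInfinity

variable {f g : E → F}

theorem congr (hf : SmoothAtInfinity f) (h : f =ᶠ[cobounded E] g) : SmoothAtInfinity g := by
  filter_upwards [hf, eventually_cobounded_eventually_nhds h] with z hz hfg
  exact hz.congr_of_eventuallyEq (hfg.mono fun _ hw => hw.symm)

theorem differentiableAt (hf : SmoothAtInfinity f) :
    ∀ᶠ z in cobounded E, DifferentiableAt ℝ f z :=
  hf.mono fun _ hz => hz.differentiableAt (by simp)

theorem fderiv (hf : SmoothAtInfinity f) : SmoothAtInfinity (fderiv ℝ f) :=
  hf.mono fun _ hz => hz.fderiv_right (m := ∞) (by simp)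

theorem const (c : F) : SmoothAtInfinity fun _ : E => c :=
  Eventually.of_forall fun _ => contDiffAt_const

theorem add (hf : SmoothAtInfinity f) (hg : SmoothAtInfinity g) :
    SmoothAtInfinity fun z => f z + g z := by
  filter_upwards [hf, hg] with z hfz hgz using hfz.add hgz

theorem clm_comp (L : F →L[ℝ] G) (hf : SmoothAtInfinity f) :
    SmoothAtInfinity fun z => L (f z) := by
  filter_upwards [hf] with z hz using L.contDiff.contDiffAt.comp z hz

theorem bilin (L : F →L[ℝ] G →L[ℝ] H) {g : E → G} (hf : SmoothAtInfinity f)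
    (hg : SmoothAtInfinity g) : SmoothAtInfinity fun z => L (f z) (g z) := by
  filter_upwards [hf.clm_comp L, hg] with z hfz hgz using hfz.clm_apply hgz

end SmoothAtInfinity

/-- The derivative of `f` along the vector field `X a`. -/
def frameDeriv (X : ι → E → E) (a : ι) (f : E → F) (z : E) : F := fderiv ℝ f z (X a z)

/-- Symbols of order `n` and weight `w`: `f` and its derivatives up to order `n` along the vector
fields `X a` are smooth near infinity and `O(w)`. -/
def IsSymbol (X : ι → E → E) (w : E → ℝ) : ℕ → (E → F) → Prop
  | 0, f => SmoothAtInfinity f ∧ f =O[cobounded E] w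
  | n + 1, f => (SmoothAtInfinity f ∧ f =O[cobounded E] w) ∧
      ∀ a, IsSymbol X w n (frameDeriv X a f)

/-- The exterior derivative `(dγ)(Z, W) = D_Z γ(W) - D_W γ(Z)` of a 1-form with values in `F`. -/
def dOneForm (γ : E → E →L[ℝ] F) (z Z W : E) : F := fderiv ℝ γ z Z W - fderiv ℝ γ z W Z

theorem dOneForm_clm_comp (L : F →L[ℝ] G) {γ : E → E →L[ℝ] F} {z : E}
    (hγ : DifferentiableAt ℝ γ z) (Z W : E) :
    dOneForm (fun w => L ∘L γ w) z Z W = L (dOneForm γ z Z W) := by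
  rw [dOneForm, ((hasFDerivAt_const L z).clm_comp hγ.hasFDerivAt).fderiv, dOneForm, map_sub]
  simp

theorem dOneForm_congr {γ γ' : E → E →L[ℝ] F} {z : E} (h : γ =ᶠ[𝓝 z] γ') (Z W : E) :
    dOneForm γ z Z W = dOneForm γ' z Z W := by
  rw [dOneForm, dOneForm, h.fderiv_eq]

theorem dOneForm_add {γ γ' : E → E →L[ℝ] F} {z : E} (hγ : DifferentiableAt ℝ γ z)
    (hγ' : DifferentiableAt ℝ γ' z) (Z W : E) :
    dOneForm (fun w => γ w + γ' w) z Z W = dOneForm γ z Z W + dOneForm γ' z Z W := by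
  simp only [dOneForm, fderiv_fun_add hγ hγ', add_apply]
  abel

theorem dOneForm_sum_smulRight {κ : Type*} [Fintype κ] {θ : κ → E → E →L[ℝ] ℝ}
    {f : κ → E → F} {z : E} (hθ : ∀ c, DifferentiableAt ℝ (θ c) z)
    (hf : ∀ c, DifferentiableAt ℝ (f c) z) (Z W : E) :
    dOneForm (fun w => ∑ c, (θ c w).smulRight (f c w)) z Z W =
      ∑ c, (θ c z W • fderiv ℝ (f c) z Z - θ c z Z • fderiv ℝ (f c) z W
        + dOneForm (θ c) z Z W • f c z) := by
  have hD : HasFDerivAt (fun w => ∑ c, (θ c w).smulRight (f c w)) _ z :=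
    HasFDerivAt.fun_sum fun c (_ : c ∈ Finset.univ) =>
      (ContinuousLinearMap.smulRightL ℝ E F).hasFDerivAt_of_bilinear
        (hθ c).hasFDerivAt (hf c).hasFDerivAt
  rw [dOneForm, hD.fderiv]
  simp only [sum_apply, ← Finset.sum_sub_distrib]
  refine Finset.sum_congr rfl fun c _ => ?_
  simp [dOneForm, sub_smul]
  abel

theorem dOneForm_sub {γ γ' : E → E →L[ℝ] F} {z : E} (hγ : DifferentiableAt ℝ γ z)
    (hγ' : DifferentiableAt ℝ γ' z) (Z W : E) :
    dOneForm (fun w => γ w - γ' w) z Z W = dOneForm γ z Z W - dOneForm γ' z Z W := by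
  simp only [dOneForm, fderiv_fun_sub hγ hγ', sub_apply]
  abel

theorem dOneForm_const_smul [NormedSpace ℂ F] {γ : E → E →L[ℝ] F} {z : E}
    (hγ : DifferentiableAt ℝ γ z) (c : ℂ) (Z W : E) :
    dOneForm (fun w => c • γ w) z Z W = c • dOneForm γ z Z W := by
  simp only [dOneForm, fderiv_fun_const_smul hγ, smul_apply, smul_sub]

theorem dOneForm_fderiv {f : E → F} {z : E} (hf : ContDiffAt ℝ ∞ f z) (Z W : E) :
    dOneForm (fderiv ℝ f) z Z W = 0 := by
  have h := hf.isSymmSndFDerivAt (by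
    rw [minSmoothness_of_isRCLikeNormedField]
    exact WithTop.coe_le_coe.2 le_top)
  rw [dOneForm, h Z W, sub_self]

variable {X : ι → E → E}

theorem frameDeriv_eq {f : E → F} {f' : E →L[ℝ] F} {z : E} (h : HasFDerivAt f f' z) (a : ι) :
    frameDeriv X a f z = f' (X a z) := by
  rw [frameDeriv, h.fderiv]

theorem frameDeriv_smul {f : E → ℝ} {g : E → F} {z : E} (hf : DifferentiableAt ℝ f z)
    (hg : DifferentiableAt ℝ g z) (a : ι) :
    frameDeriv X a (fun z => f z • g z) z =
      f z • frameDeriv X a g z + frameDeriv X a f z • g z := by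
  simp [frameDeriv, fderiv_fun_smul hf hg]

theorem frameDeriv_const_smul {f : E → F} {z : E} (hf : DifferentiableAt ℝ f z) (c : ℝ) (a : ι) :
    frameDeriv X a (fun z => c • f z) z = c • frameDeriv X a f z := by
  simp [frameDeriv, fderiv_fun_const_smul hf]

theorem frameDeriv_congr {f g : E → F} (h : f =ᶠ[cobounded E] g) (a : ι) :
    frameDeriv X a f =ᶠ[cobounded E] frameDeriv X a g := by
  filter_upwards [eventually_cobounded_eventually_nhds h] with z hz
  rw [frameDeriv, frameDeriv, EventuallyEq.fderiv_eq hz]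

theorem frameDeriv_const (a : ι) (c : F) : frameDeriv X a (fun _ => c) = fun _ => 0 := by
  ext z
  simp [frameDeriv]

namespace IsSymbol

variable {w w₁ w₂ : E → ℝ} {n : ℕ} {f g : E → F}

theorem smooth (hf : IsSymbol X w n f) : SmoothAtInfinity f := by
  cases n with
  | zero => exact hf.1
  | succ n => exact hf.1.1

theorem isBigO (hf : IsSymbol X w n f) : f =O[cobounded E] w := by
  cases n with
  | zero => exact hf.2
  | succ n => exact hf.1.2

theorem frameDeriv (hf : IsSymbol X w (n + 1) f) (a : ι) :
    IsSymbol X w n (frameDeriv X a f) :=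
  hf.2 a

theorem pred (hf : IsSymbol X w (n + 1) f) : IsSymbol X w n f := by
  induction n generalizing f with
  | zero => exact hf.1
  | succ n ih => exact ⟨hf.1, fun a => ih (hf.frameDeriv a)⟩

theorem congr (hf : IsSymbol X w n f) (h : f =ᶠ[cobounded E] g) : IsSymbol X w n g := by
  have h0 : SmoothAtInfinity g ∧ g =O[cobounded E] w :=
    ⟨hf.smooth.congr h, hf.isBigO.congr' h EventuallyEq.rfl⟩
  induction n generalizing f g with
  | zero => exact h0
  | succ n ih =>
    have hD (a : ι) := frameDeriv_congr (X := X) h a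
    exact ⟨h0, fun a => ih (hf.frameDeriv a) (hD a)
      ⟨(hf.frameDeriv a).smooth.congr (hD a),
        (hf.frameDeriv a).isBigO.congr' (hD a) EventuallyEq.rfl⟩⟩

theorem of_frameDeriv {f' : ι → E → F} (hs : SmoothAtInfinity f) (hO : f =O[cobounded E] w)
    (hf' : ∀ a, IsSymbol X w n (f' a)) (h : ∀ a, f' a =ᶠ[cobounded E] TaubNUT.frameDeriv X a f) :
    IsSymbol X w (n + 1) f :=
  ⟨⟨hs, hO⟩, fun a => (hf' a).congr (h a)⟩

theorem weight (hf : IsSymbol X w₁ n f) (h : w₁ =O[cobounded E] w₂) : IsSymbol X w₂ n f := by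
  induction n generalizing f with
  | zero => exact ⟨hf.1, hf.2.trans h⟩
  | succ n ih => exact ⟨⟨hf.smooth, hf.isBigO.trans h⟩, fun a => ih (hf.frameDeriv a)⟩

theorem const (c : F) : IsSymbol X (fun _ => 1) n (fun _ : E => c) := by
  have hO (c : F) : (fun _ : E => c) =O[cobounded E] (fun _ => (1 : ℝ)) :=
    isBigO_const_const _ one_ne_zero _
  induction n generalizing c with
  | zero => exact ⟨.const c, hO c⟩
  | succ n ih => exact ⟨⟨.const c, hO c⟩, fun a => by simpa only [frameDeriv_const] using ih 0⟩

theorem zero : IsSymbol X w n (fun _ : E => (0 : F)) := by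
  induction n with
  | zero => exact ⟨.const 0, isBigO_zero _ _⟩
  | succ n ih => exact ⟨⟨.const 0, isBigO_zero _ _⟩, fun a => by simpa only [frameDeriv_const]⟩

theorem add (hf : IsSymbol X w n f) (hg : IsSymbol X w n g) :
    IsSymbol X w n (fun z => f z + g z) := by
  induction n generalizing f g with
  | zero => exact ⟨hf.1.add hg.1, hf.2.add hg.2⟩
  | succ n ih =>
    refine of_frameDeriv (hf.smooth.add hg.smooth) (hf.isBigO.add hg.isBigO)
      (fun a => ih (hf.frameDeriv a) (hg.frameDeriv a)) fun a => ?_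
    filter_upwards [hf.smooth.differentiableAt, hg.smooth.differentiableAt] with z hfz hgz
    simp only [TaubNUT.frameDeriv, fderiv_fun_add hfz hgz, add_apply]

theorem clm_comp (L : F →L[ℝ] G) (hf : IsSymbol X w n f) :
    IsSymbol X w n (fun z => L (f z)) := by
  induction n generalizing f with
  | zero => exact ⟨hf.1.clm_comp L, (L.isBigO_comp _ _).trans hf.2⟩
  | succ n ih =>
    refine of_frameDeriv (hf.smooth.clm_comp L) ((L.isBigO_comp _ _).trans hf.isBigO)
      (fun a => ih (hf.frameDeriv a)) fun a => ?_
    filter_upwards [hf.smooth.differentiableAt] with z hz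
    exact (congrArg (· (X a z)) (L.hasFDerivAt.comp z hz.hasFDerivAt).fderiv).symm

theorem neg (hf : IsSymbol X w n f) : IsSymbol X w n (fun z => -f z) := by
  simpa using hf.clm_comp (-ContinuousLinearMap.id ℝ F)

theorem sub (hf : IsSymbol X w n f) (hg : IsSymbol X w n g) :
    IsSymbol X w n (fun z => f z - g z) := by
  simpa only [sub_eq_add_neg] using hf.add hg.neg

theorem sum {κ : Type*} (s : Finset κ) {f : κ → E → F} (hf : ∀ k ∈ s, IsSymbol X w n (f k)) :
    IsSymbol X w n (fun z => ∑ k ∈ s, f k z) := by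
  classical
  induction s using Finset.induction_on with
  | empty => simpa using zero
  | insert k s hk ih =>
    simp only [Finset.sum_insert hk]
    exact (hf k (Finset.mem_insert_self _ _)).add
      (ih fun j hj => hf j (Finset.mem_insert_of_mem hj))

theorem bilin (L : F →L[ℝ] G →L[ℝ] H) {g : E → G} (hf : IsSymbol X w₁ n f)
    (hg : IsSymbol X w₂ n g) :
    IsSymbol X (fun z => w₁ z * w₂ z) n (fun z => L (f z) (g z)) := by
  induction n generalizing f g with
  | zero => exact ⟨hf.1.bilin L hg.1, isBigO_bilin L hf.2 hg.2⟩
  | succ n ih =>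
    refine of_frameDeriv (hf.smooth.bilin L hg.smooth) (isBigO_bilin L hf.isBigO hg.isBigO)
      (fun a => (ih (hf.frameDeriv a) hg.pred).add (ih hf.pred (hg.frameDeriv a))) fun a => ?_
    filter_upwards [hf.smooth.differentiableAt, hg.smooth.differentiableAt] with z hfz hgz
    simp only [TaubNUT.frameDeriv,
      (L.hasFDerivAt_of_bilinear hfz.hasFDerivAt hgz.hasFDerivAt).fderiv]
    simp [add_comm]

theorem smul {f : E → ℝ} (hf : IsSymbol X w₁ n f) (hg : IsSymbol X w₂ n g) :
    IsSymbol X (fun z => w₁ z * w₂ z) n (fun z => f z • g z) := by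
  simpa using bilin (ContinuousLinearMap.lsmul ℝ ℝ) hf hg

theorem smul_left {f : E → ℝ} (hf : IsSymbol X (fun _ => 1) n f) (hg : IsSymbol X w n g) :
    IsSymbol X w n (fun z => f z • g z) := by
  simpa using hf.smul hg

variable {A : Type*} [NormedRing A] [NormedAlgebra ℝ A]

theorem mul {f g : E → A} (hf : IsSymbol X w₁ n f) (hg : IsSymbol X w₂ n g) :
    IsSymbol X (fun z => w₁ z * w₂ z) n (fun z => f z * g z) := by
  simpa using bilin (ContinuousLinearMap.mul ℝ A) hf hg

theorem mul_left {f g : E → A} (hf : IsSymbol X (fun _ => 1) n f) (hg : IsSymbol X w n g) :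
    IsSymbol X w n (fun z => f z * g z) := by
  simpa using hf.mul hg

theorem const_mul (c : A) {f : E → A} (hf : IsSymbol X w n f) :
    IsSymbol X w n (fun z => c * f z) :=
  (const c).mul_left hf

theorem inv {f : E → ℝ} (hf : IsSymbol X (fun _ => 1) n f) {c : ℝ} (hc : 0 < c)
    (h : ∀ᶠ z in cobounded E, c ≤ f z) : IsSymbol X (fun _ => 1) n (fun z => (f z)⁻¹) := by
  have hs : SmoothAtInfinity (fun z => (f z)⁻¹) := by
    filter_upwards [hf.smooth, h] with z hz hcz using hz.inv (hc.trans_le hcz).ne'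
  have hO : (fun z => (f z)⁻¹) =O[cobounded E] (fun _ => (1 : ℝ)) := by
    refine .of_bound c⁻¹ ?_
    filter_upwards [h] with z hz
    rw [norm_inv, Real.norm_of_nonneg (hc.le.trans hz)]
    simpa using inv_anti₀ hc hz
  induction n with
  | zero => exact ⟨hs, hO⟩
  | succ n ih =>
    refine of_frameDeriv hs hO
      (fun a => ((ih hf.pred).mul_left ((ih hf.pred).mul_left (hf.frameDeriv a))).neg) fun a => ?_
    filter_upwards [hf.smooth.differentiableAt, h] with z hz hcz
    have hne : f z ≠ 0 := (hc.trans_le hcz).ne'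
    have hD : fderiv ℝ (fun w => (f w)⁻¹) z = -(f z ^ 2)⁻¹ • fderiv ℝ f z :=
      ((hasDerivAt_inv hne).comp_hasFDerivAt z hz.hasFDerivAt).fderiv
    simp only [TaubNUT.frameDeriv, hD, smul_apply, smul_eq_mul]
    ring

theorem iteratedFDeriv_of_isBigO (hX : ∀ a n, IsSymbol X (fun z => ‖z‖) n (X a)) {p : ℕ}
    (hs : ∀ k : ℕ, SmoothAtInfinity (iteratedFDeriv ℝ k f))
    (hO : ∀ k : ℕ, (fun z => ‖iteratedFDeriv ℝ k f z‖) =O[cobounded E]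
      fun z => (‖z‖ ^ (p + k))⁻¹) (k : ℕ) :
    IsSymbol X (fun z => (‖z‖ ^ (p + k))⁻¹) n (iteratedFDeriv ℝ k f) := by
  induction n generalizing k with
  | zero => exact ⟨hs k, (hO k).of_norm_left⟩
  | succ n ih =>
    let curry := (continuousMultilinearCurryLeftEquiv ℝ (fun _ : Fin (k + 1) => E) F)
    refine of_frameDeriv (hs k) (hO k).of_norm_left (fun a => ?_)
      (f' := fun a z => curry (iteratedFDeriv ℝ (k + 1) f z) (X a z)) fun a => ?_
    · refine ((ih (k + 1)).bilin curry.toContinuousLinearEquiv.toContinuousLinearMap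
        (hX a n)).weight (.of_bound 1 (.of_forall fun z => ?_))
      rcases eq_or_ne ‖z‖ 0 with h | h
      · simp [h]
      · rw [← add_assoc, pow_succ, mul_inv, mul_assoc, inv_mul_cancel₀ h]
        simp
    · exact .of_forall fun z => by rw [TaubNUT.frameDeriv, fderiv_iteratedFDeriv]; rfl

theorem of_iteratedFDeriv (hX : ∀ a n, IsSymbol X (fun z => ‖z‖) n (X a)) {p : ℕ}
    (hf : SmoothAtInfinity f)
    (hO : ∀ k : ℕ, (fun z => ‖iteratedFDeriv ℝ k f z‖) =O[cobounded E]
      fun z => (‖z‖ ^ (p + k))⁻¹) :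
    IsSymbol X (fun z => (‖z‖ ^ p)⁻¹) n f := by
  have hs (k : ℕ) : SmoothAtInfinity (iteratedFDeriv ℝ k f) :=
    hf.mono fun _ hz => hz.iteratedFDeriv_right (m := ∞) (i := k) (by norm_cast)
  exact (iteratedFDeriv_of_isBigO hX hs hO 0).clm_comp
    (continuousMultilinearCurryFin0 ℝ E F).toContinuousLinearEquiv.toContinuousLinearMap

end IsSymbol

end Symbols

/-! ### Tensor calculus in a frame diagonalizing the metric -/

theorem card_fin_four_eq_finrank : Fintype.card (Fin 4) = Module.finrank ℝ C2 := by
  rw [Fintype.card_fin, finrank_real_of_complex, finrank_euclideanSpace_fin]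

theorem sum_dual_smul {ι K E : Type*} [Fintype ι] [Nonempty ι] [DecidableEq ι] [Field K]
    [AddCommGroup E] [Module K E] (hcard : Fintype.card ι = Module.finrank K E) {e : ι → E}
    {φ : ι → E →ₗ[K] K} (h : ∀ a b, φ a (e b) = if a = b then 1 else 0) (Z : E) :
    ∑ a, φ a Z • e a = Z := by
  have hcoeff (c : ι → K) (a : ι) : φ a (∑ b, c b • e b) = c a := by simp [h]
  have hli : LinearIndependent K e :=
    Fintype.linearIndependent_iff.2 fun c hc a => by rw [← hcoeff c a, hc, map_zero]
  let b := basisOfLinearIndependentOfCardEqFinrank hli hcard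
  have hZ : ∑ a, b.repr Z a • e a = Z := by simpa [b] using b.sum_repr Z
  rw [← hZ]
  simp only [hcoeff]

theorem prod_apply_update {ι α : Type*} [Fintype ι] [DecidableEq ι] (F : ι → α → ℝ) (x : ι → α)
    (j : ι) (u : α) :
    ∏ l, F l (Function.update x j u l) = (∏ l ∈ Finset.univ.erase j, F l (x l)) * F j u := by
  rw [← Finset.prod_erase_mul _ _ (Finset.mem_univ j), Function.update_self]
  congr 1
  exact Finset.prod_congr rfl fun l hl => by
    rw [Function.update_of_ne (Finset.ne_of_mem_erase hl)]

/-- The right hand side of the Koszul formula for constant vector fields. -/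
def koszul (g : C2 → C2 → C2 → ℝ) (z U W Z : C2) : ℝ :=
  fderiv ℝ (fun w => g w W Z) z U + fderiv ℝ (fun w => g w U Z) z W
    - fderiv ℝ (fun w => g w U W) z Z

/-- The covariant derivative `(∇_U θᶜ)(W)` of the coframe `θ` dual to `e`, for the Levi-Civita
connection of `∑ₐ hₐ θᵃ ⊗ θᵃ`. Only the exterior derivatives of the `θᵃ` enter the formula. -/
def nablaCoframe (e : Fin 4 → C2 → C2) (θ : Fin 4 → C2 → C2 →L[ℝ] ℝ) (h : Fin 4 → C2 → ℝ)
    (c : Fin 4) (z U W : C2) : ℝ :=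
  2⁻¹ * dOneForm (θ c) z U W
    - 2⁻¹ * (h c z)⁻¹ * (fderiv ℝ (h c) z U * θ c z W + fderiv ℝ (h c) z W * θ c z U
      + ∑ a, (h a z * (θ a z W * dOneForm (θ a) z U (e c z)
          + θ a z U * dOneForm (θ a) z W (e c z))
        - fderiv ℝ (h a) z (e c z) * (θ a z U * θ a z W)))

/-- `e` is a frame at `z` with dual coframe `θ`, and `g = ∑ₐ hₐ θᵃ ⊗ θᵃ` near `z`. -/
structure IsDiagonalFrameAt (g : C2 → C2 → C2 → ℝ) (e : Fin 4 → C2 → C2)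
    (θ : Fin 4 → C2 → C2 →L[ℝ] ℝ) (h : Fin 4 → C2 → ℝ) (z : C2) : Prop where
  coframe_frame : ∀ a b, θ a z (e b z) = if a = b then 1 else 0
  eventually_metric_eq : ∀ᶠ w in 𝓝 z, ∀ Z W, g w Z W = ∑ a, h a w * (θ a w Z * θ a w W)
  diag_pos : ∀ a, 0 < h a z
  differentiableAt_diag : ∀ a, DifferentiableAt ℝ (h a) z
  differentiableAt_coframe : ∀ a, DifferentiableAt ℝ (θ a) z

namespace IsDiagonalFrameAt

variable {g : C2 → C2 → C2 → ℝ} {e : Fin 4 → C2 → C2} {θ : Fin 4 → C2 → C2 →L[ℝ] ℝ}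
  {h : Fin 4 → C2 → ℝ} {z : C2} {F : Type*} [NormedAddCommGroup F] [NormedSpace ℝ F]

theorem metric_eq (H : IsDiagonalFrameAt g e θ h z) (Z W : C2) :
    g z Z W = ∑ a, h a z * (θ a z Z * θ a z W) :=
  H.eventually_metric_eq.self_of_nhds Z W

theorem map_eq_sum (H : IsDiagonalFrameAt g e θ h z) (L : C2 →L[ℝ] F) (Z : C2) :
    L Z = ∑ a, θ a z Z • L (e a z) := by
  have hexp := sum_dual_smul card_fin_four_eq_finrank (e := (e · z)) (φ := (θ · z))
    H.coframe_frame Z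
  conv_lhs => rw [← hexp]
  simp

theorem bilin_eq_sum (H : IsDiagonalFrameAt g e θ h z) (B : C2 →ₗ[ℝ] C2 →ₗ[ℝ] F) (Z W : C2) :
    B Z W = ∑ a, ∑ b, (θ a z Z * θ b z W) • B (e a z) (e b z) := by
  have hexp := sum_dual_smul card_fin_four_eq_finrank (e := (e · z)) (φ := (θ · z))
    H.coframe_frame
  conv_lhs => rw [← hexp Z, ← hexp W]
  simp only [map_sum, map_smul, LinearMap.sum_apply, LinearMap.smul_apply, mul_smul,
    Finset.smul_sum]
  rw [Finset.sum_comm]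
  exact Finset.sum_congr rfl fun a _ => Finset.sum_congr rfl fun b _ => smul_comm _ _ _

theorem isOrthonormalFrame_orthoFrame (H : IsDiagonalFrameAt g e θ h z) :
    IsOrthonormalFrame (g z) (orthoFrame (g z)) := by
  refine Classical.epsilon_spec (p := IsOrthonormalFrame (g z))
    ⟨fun a => (Real.sqrt (h a z))⁻¹ • e a z, fun i j => ?_⟩
  have hsqrt := Real.mul_self_sqrt (H.diag_pos i).le
  have hne := (Real.sqrt_pos.2 (H.diag_pos i)).ne'
  simp only [H.metric_eq, map_smul, H.coframe_frame, smul_eq_mul, mul_ite, mul_one, mul_zero,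
    ite_mul, zero_mul, Finset.sum_ite_eq', Finset.mem_univ, if_true]
  rcases eq_or_ne i j with rfl | hij
  · simp only [if_true]
    field_simp
    linarith
  · simp [hij, hij.symm]

theorem metric_comm (H : IsDiagonalFrameAt g e θ h z) (Z W : C2) : g z Z W = g z W Z := by
  simp only [H.metric_eq, mul_comm (θ _ z Z)]

theorem isLinearMap_metric (H : IsDiagonalFrameAt g e θ h z) (Z : C2) :
    IsLinearMap ℝ (g z Z) where
  map_add U W := by
    simp only [H.metric_eq, map_add, mul_add, Finset.sum_add_distrib]
  map_smul c W := by
    simp only [H.metric_eq, map_smul, smul_eq_mul, Finset.mul_sum]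
    exact Finset.sum_congr rfl fun _ _ => by ring

theorem sum_metric_smul_orthoFrame (H : IsDiagonalFrameAt g e θ h z) (Z : C2) :
    ∑ a, g z (orthoFrame (g z) a) Z • orthoFrame (g z) a = Z :=
  sum_dual_smul card_fin_four_eq_finrank
    (φ := fun a => (H.isLinearMap_metric (orthoFrame (g z) a)).mk')
    H.isOrthonormalFrame_orthoFrame Z

theorem hasFDerivAt_coframe_apply (H : IsDiagonalFrameAt g e θ h z) (a : Fin 4) (W : C2) :
    HasFDerivAt (fun w => θ a w W) ((fderiv ℝ (θ a) z).flip W) z := by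
  simpa using (H.differentiableAt_coframe a).hasFDerivAt.clm_apply (hasFDerivAt_const W z)

theorem fderiv_metric (H : IsDiagonalFrameAt g e θ h z) (U W Z : C2) :
    fderiv ℝ (fun w => g w W Z) z U = ∑ a, (fderiv ℝ (h a) z U * (θ a z W * θ a z Z)
      + h a z * (fderiv ℝ (θ a) z U W * θ a z Z + θ a z W * fderiv ℝ (θ a) z U Z)) := by
  have hsum : HasFDerivAt (fun w => ∑ a, h a w * (θ a w W * θ a w Z)) _ z :=
    HasFDerivAt.fun_sum fun a (_ : a ∈ Finset.univ) =>
      (H.differentiableAt_diag a).hasFDerivAt.mul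
        ((H.hasFDerivAt_coframe_apply a W).mul (H.hasFDerivAt_coframe_apply a Z))
  have hg : (fun w => g w W Z) =ᶠ[𝓝 z] fun w => ∑ a, h a w * (θ a w W * θ a w Z) :=
    H.eventually_metric_eq.mono fun w hw => hw W Z
  rw [(hsum.congr_of_eventuallyEq hg).fderiv]
  simp only [sum_apply, add_apply, smul_apply, smul_eq_mul, ContinuousLinearMap.flip_apply]
  exact Finset.sum_congr rfl fun a _ => by ring

theorem koszul_eq (H : IsDiagonalFrameAt g e θ h z) (U W Z : C2) :
    koszul g z U W Z = ∑ a, (θ a z Z * (fderiv ℝ (h a) z U * θ a z W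
          + fderiv ℝ (h a) z W * θ a z U
          + h a z * (fderiv ℝ (θ a) z U W + fderiv ℝ (θ a) z W U))
      + (h a z * (θ a z W * dOneForm (θ a) z U Z + θ a z U * dOneForm (θ a) z W Z)
        - fderiv ℝ (h a) z Z * (θ a z U * θ a z W))) := by
  simp only [koszul, H.fderiv_metric, ← Finset.sum_add_distrib, ← Finset.sum_sub_distrib]
  refine Finset.sum_congr rfl fun a _ => ?_
  simp only [dOneForm]
  ring

theorem isLinearMap_koszul (H : IsDiagonalFrameAt g e θ h z) (U W : C2) :
    IsLinearMap ℝ (koszul g z U W) where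
  map_add Z₁ Z₂ := by
    simp only [H.koszul_eq, dOneForm, map_add, add_apply, ← Finset.sum_add_distrib]
    exact Finset.sum_congr rfl fun _ _ => by ring
  map_smul c Z := by
    simp only [H.koszul_eq, dOneForm, map_smul, smul_apply, smul_eq_mul, Finset.mul_sum]
    exact Finset.sum_congr rfl fun _ _ => by ring

theorem metric_christoffel (H : IsDiagonalFrameAt g e θ h z) (U W Z : C2) :
    g z Z (christoffel g z U W) = 2⁻¹ * koszul g z U W Z := by
  let G := (H.isLinearMap_metric Z).mk'
  let K := (H.isLinearMap_koszul U W).mk'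
  calc g z Z (christoffel g z U W)
      = G (∑ a, (K (orthoFrame (g z) a) / 2) • orthoFrame (g z) a) := rfl
    _ = 2⁻¹ * K (∑ a, g z (orthoFrame (g z) a) Z • orthoFrame (g z) a) := by
      simp only [map_sum, map_smul, smul_eq_mul, Finset.mul_sum, H.metric_comm _ Z]
      exact Finset.sum_congr rfl fun a _ => by simp only [G, K, IsLinearMap.mk'_apply]; ring
    _ = 2⁻¹ * koszul g z U W Z := by rw [H.sum_metric_smul_orthoFrame]; rfl

theorem diag_mul_coframe_christoffel (H : IsDiagonalFrameAt g e θ h z) (U W : C2) (c : Fin 4) :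
    h c z * θ c z (christoffel g z U W) = 2⁻¹ * koszul g z U W (e c z) := by
  simp [← H.metric_christoffel, H.metric_eq, H.coframe_frame]

theorem fderiv_coframe_sub_coframe_christoffel (H : IsDiagonalFrameAt g e θ h z) (c : Fin 4)
    (U W : C2) :
    fderiv ℝ (θ c) z U W - θ c z (christoffel g z U W) = nablaCoframe e θ h c z U W := by
  have hne := (H.diag_pos c).ne'
  have hc := H.diag_mul_coframe_christoffel U W c
  simp only [H.koszul_eq, Finset.sum_add_distrib, H.coframe_frame, ite_mul, one_mul, zero_mul,
    Finset.sum_ite_eq', Finset.mem_univ, if_true] at hc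
  rw [nablaCoframe, eq_div_of_mul_eq hne ((mul_comm _ _).trans hc)]
  nth_rewrite 1 [dOneForm]
  field_simp
  ring

theorem nablaCoframe_eq_sum (H : IsDiagonalFrameAt g e θ h z) (c : Fin 4) (U W : C2) :
    nablaCoframe e θ h c z U W = ∑ a, ∑ b, (θ a z U * θ b z W) •
      nablaCoframe e θ h c z (e a z) (e b z) := by
  refine H.bilin_eq_sum (LinearMap.mk₂ ℝ (nablaCoframe e θ h c z) ?_ ?_ ?_ ?_) U W <;> intros <;>
    simp only [nablaCoframe, dOneForm, map_add, add_apply, map_smul, smul_apply, smul_eq_mul,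
      Fin.sum_univ_four] <;> ring

theorem hasFDerivAt_prod_coframe_smul (H : IsDiagonalFrameAt g e θ h z) {k : ℕ}
    (i : Fin k → Fin 4) {f : C2 → ℂ} (hf : DifferentiableAt ℝ f z) (X : Fin k → C2) :
    HasFDerivAt (fun w => (∏ j, θ (i j) w (X j)) • f w)
      ((∏ j, θ (i j) z (X j)) • fderiv ℝ f z
        + (∑ j, (∏ l ∈ Finset.univ.erase j, θ (i l) z (X l)) •
          (fderiv ℝ (θ (i j)) z).flip (X j)).smulRight (f z)) z :=
  (HasFDerivAt.finsetProd fun j (_ : j ∈ Finset.univ) =>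
    H.hasFDerivAt_coframe_apply (i j) (X j)).smul hf.hasFDerivAt

theorem covDeriv_prod_coframe_smul (H : IsDiagonalFrameAt g e θ h z) {k : ℕ} (i : Fin k → Fin 4)
    {f : C2 → ℂ} (hf : DifferentiableAt ℝ f z) (Z : Fin (k + 1) → C2) :
    covDeriv g (fun w X => (∏ j, θ (i j) w (X j)) • f w) z Z =
      (∏ j, θ (i j) z (Fin.tail Z j)) • fderiv ℝ f z (Z 0)
      + ∑ j, ((∏ l ∈ Finset.univ.erase j, θ (i l) z (Fin.tail Z l))
          * nablaCoframe e θ h (i j) z (Z 0) (Fin.tail Z j)) • f z := by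
  rw [covDeriv, (H.hasFDerivAt_prod_coframe_smul i hf (Fin.tail Z)).fderiv]
  simp only [add_apply, smul_apply, ContinuousLinearMap.smulRight_apply, sum_apply, smul_eq_mul,
    ContinuousLinearMap.flip_apply, prod_apply_update (fun l => θ (i l) z), ← Finset.sum_smul,
    ← H.fderiv_coframe_sub_coframe_christoffel, mul_sub, Finset.sum_sub_distrib, sub_smul]
  exact add_sub_assoc _ _ _

theorem covDeriv_prod_coframe_smul_eq_sum (H : IsDiagonalFrameAt g e θ h z) {k : ℕ}
    (i : Fin k → Fin 4) {f : C2 → ℂ} (hf : DifferentiableAt ℝ f z) (Z : Fin (k + 1) → C2) :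
    covDeriv g (fun w X => (∏ j, θ (i j) w (X j)) • f w) z Z =
      (∑ a, (∏ l, θ ((Fin.cons a i : Fin (k + 1) → Fin 4) l) z (Z l)) • frameDeriv e a f z)
      + ∑ j, ∑ a, ∑ b,
        (∏ l, θ ((Fin.cons a (Function.update i j b) : Fin (k + 1) → Fin 4) l) z (Z l)) •
          (nablaCoframe e θ h (i j) z (e a z) (e b z) • f z) := by
  have hcons (a : Fin 4) (i' : Fin k → Fin 4) :
      ∏ l, θ ((Fin.cons a i' : Fin (k + 1) → Fin 4) l) z (Z l)
        = θ a z (Z 0) * ∏ l, θ (i' l) z (Fin.tail Z l) := Fin.prod_univ_succ _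
  rw [H.covDeriv_prod_coframe_smul i hf, H.map_eq_sum (fderiv ℝ f z) (Z 0)]
  simp only [hcons, prod_apply_update fun l b => θ b z (Fin.tail Z l), frameDeriv,
    Finset.smul_sum, H.nablaCoframe_eq_sum _ (Z 0), Finset.mul_sum, Finset.sum_smul, smul_smul,
    smul_eq_mul]
  congr 1
  · exact Finset.sum_congr rfl fun a _ => by rw [mul_comm]
  · refine Finset.sum_congr rfl fun j _ => Finset.sum_congr rfl fun a _ =>
      Finset.sum_congr rfl fun b _ => ?_
    congr 1
    ring

end IsDiagonalFrameAt

theorem covDeriv_congr {g : C2 → C2 → C2 → ℝ} {k : ℕ} {T S : CTensor k} {z : C2}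
    (h : T =ᶠ[𝓝 z] S) : covDeriv g T z = covDeriv g S z := by
  ext X
  have hX : (fun w => T w (Fin.tail X)) =ᶠ[𝓝 z] fun w => S w (Fin.tail X) :=
    h.mono fun w hw => congrFun hw _
  simp only [covDeriv, hX.fderiv_eq, h.self_of_nhds]

theorem covDeriv_sum {g : C2 → C2 → C2 → ℝ} {k : ℕ} {κ : Type*} [Fintype κ] {T : κ → CTensor k}
    {z : C2} (hT : ∀ i X, DifferentiableAt ℝ (fun w => T i w X) z) (X : Fin (k + 1) → C2) :
    covDeriv g (fun w Z => ∑ i, T i w Z) z X = ∑ i, covDeriv g (T i) z X := by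
  simp only [covDeriv, fderiv_fun_sum fun i _ => hT i (Fin.tail X), sum_apply,
    Finset.sum_sub_distrib]
  rw [Finset.sum_comm]

/-- A frame near infinity in which `g` is diagonal and whose structure functions are symbols: this
is what makes covariant differentiation preserve the decay of tensors. -/
structure IsSymbolicFrame (g : C2 → C2 → C2 → ℝ) (e : Fin 4 → C2 → C2)
    (θ : Fin 4 → C2 → C2 →L[ℝ] ℝ) (h : Fin 4 → C2 → ℝ) : Prop where
  eventually_isDiagonalFrameAt : ∀ᶠ z in cobounded C2, IsDiagonalFrameAt g e θ h z
  isSymbol_diag : ∀ a n, IsSymbol e (fun _ => 1) n (h a)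
  isSymbol_inv_diag : ∀ a n, IsSymbol e (fun _ => 1) n fun z => (h a z)⁻¹
  isSymbol_dOneForm : ∀ c a b n,
    IsSymbol e (fun _ => 1) n fun z => dOneForm (θ c) z (e a z) (e b z)

/-- Covariant tensor fields whose coefficients in the coframe `θ` are symbols of order `n` and
weight `w` along the frame `e`. -/
def IsTensorSymbol (e : Fin 4 → C2 → C2) (θ : Fin 4 → C2 → C2 →L[ℝ] ℝ) (w : C2 → ℝ) (n : ℕ)
    {k : ℕ} (T : CTensor k) : Prop :=
  ∃ f : (Fin k → Fin 4) → C2 → ℂ, (∀ i, IsSymbol e w n (f i)) ∧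
    ∀ᶠ z in cobounded C2, ∀ Z, T z Z = ∑ i, (∏ j, θ (i j) z (Z j)) • f i z

namespace IsTensorSymbol

variable {e : Fin 4 → C2 → C2} {θ : Fin 4 → C2 → C2 →L[ℝ] ℝ} {w : C2 → ℝ} {n k : ℕ}
  {T S : CTensor k}

theorem congr (hT : IsTensorSymbol e θ w n T) (h : T =ᶠ[cobounded C2] S) :
    IsTensorSymbol e θ w n S := by
  obtain ⟨f, hf, hTf⟩ := hT
  refine ⟨f, hf, ?_⟩
  filter_upwards [hTf, h] with z hz hTS
  rwa [← hTS]

theorem add (hT : IsTensorSymbol e θ w n T) (hS : IsTensorSymbol e θ w n S) :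
    IsTensorSymbol e θ w n (fun z Z => T z Z + S z Z) := by
  obtain ⟨f, hf, hTf⟩ := hT
  obtain ⟨f', hf', hSf'⟩ := hS
  refine ⟨fun i z => f i z + f' i z, fun i => (hf i).add (hf' i), ?_⟩
  filter_upwards [hTf, hSf'] with z hTz hSz Z
  simp only [hTz, hSz, smul_add, Finset.sum_add_distrib]

theorem sum {κ : Type*} [Fintype κ] {T : κ → CTensor k}
    (hT : ∀ c, IsTensorSymbol e θ w n (T c)) :
    IsTensorSymbol e θ w n (fun z Z => ∑ c, T c z Z) := by
  choose f hf hTf using hT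
  refine ⟨fun i z => ∑ c, f c i z, fun i => .sum _ fun c _ => hf c i, ?_⟩
  filter_upwards [eventually_all.2 hTf] with z hz Z
  simp only [hz, Finset.smul_sum]
  exact Finset.sum_comm

theorem prod_coframe_smul (i : Fin k → Fin 4) {f : C2 → ℂ} (hf : IsSymbol e w n f) :
    IsTensorSymbol e θ w n (fun z Z => (∏ j, θ (i j) z (Z j)) • f z) := by
  refine ⟨fun i' z => if i' = i then f z else 0, fun i' => ?_, .of_forall fun z Z => by simp⟩
  by_cases h : i' = i
  · simpa only [h, if_true] using hf
  · simpa only [h, if_false] using IsSymbol.zero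

theorem scalar {f : C2 → ℂ} (hf : IsSymbol e w n f) :
    IsTensorSymbol e θ w n (scalar f) := by
  simpa using! prod_coframe_smul (θ := θ) (Fin.elim0 : Fin 0 → Fin 4) hf

end IsTensorSymbol

namespace IsSymbolicFrame

variable {g : C2 → C2 → C2 → ℝ} {e : Fin 4 → C2 → C2} {θ : Fin 4 → C2 → C2 →L[ℝ] ℝ}
  {h : Fin 4 → C2 → ℝ} {w : C2 → ℝ} {n k : ℕ} {T : CTensor k}

theorem isSymbol_coframe_frame (H : IsSymbolicFrame g e θ h) (a b : Fin 4) :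
    IsSymbol e (fun _ => 1) n fun z => θ a z (e b z) :=
  (IsSymbol.const (if a = b then 1 else 0)).congr <| by
    filter_upwards [H.eventually_isDiagonalFrameAt] with z hz using (hz.coframe_frame a b).symm

theorem isSymbol_nablaCoframe (H : IsSymbolicFrame g e θ h) (a b c : Fin 4) :
    IsSymbol e (fun _ => 1) n fun z => nablaCoframe e θ h c z (e a z) (e b z) := by
  have hθ (a b : Fin 4) := H.isSymbol_coframe_frame (n := n) a b
  have hD (a b : Fin 4) := (H.isSymbol_diag b (n + 1)).frameDeriv a
  have hd (c a b : Fin 4) := H.isSymbol_dOneForm c a b n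
  exact ((hd c a b).const_mul _).sub <| ((H.isSymbol_inv_diag c n).const_mul _).mul_left <|
    (((hD a c).mul_left (hθ c b)).add ((hD b c).mul_left (hθ c a))).add <| .sum _ fun l _ =>
      ((H.isSymbol_diag l n).mul_left
        (((hθ l b).mul_left (hd l a c)).add ((hθ l a).mul_left (hd l b c)))).sub
      ((hD c l).mul_left ((hθ l a).mul_left (hθ l b)))

theorem coframe_orthoFrame_isBigO (H : IsSymbolicFrame g e θ h) (a b : Fin 4) :
    (fun z => θ a z (orthoFrame (g z) b)) =O[cobounded C2] fun _ => (1 : ℝ) := by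
  refine IsBigO.of_pow two_ne_zero ?_
  rw [show (fun _ : C2 => (1 : ℝ)) ^ 2 = fun _ => 1 from one_pow 2]
  refine .trans (.of_bound 1 ?_) (H.isSymbol_inv_diag a 0).isBigO
  filter_upwards [H.eventually_isDiagonalFrameAt] with z hz
  set u := orthoFrame (g z) b
  have hu : ∑ c, h c z * (θ c z u * θ c z u) = 1 := by
    rw [← hz.metric_eq, hz.isOrthonormalFrame_orthoFrame b b, if_pos rfl]
  have hle : h a z * (θ a z u * θ a z u) ≤ 1 := hu ▸ Finset.single_le_sum
    (fun c _ => mul_nonneg (hz.diag_pos c).le (mul_self_nonneg (θ c z u))) (Finset.mem_univ a)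
  rw [one_mul, Pi.pow_apply, norm_inv, Real.norm_of_nonneg (hz.diag_pos a).le,
    Real.norm_of_nonneg (sq_nonneg _), ← one_div, le_div_iff₀' (hz.diag_pos a), sq]
  exact hle

theorem tensorNorm_isBigO (H : IsSymbolicFrame g e θ h) (hT : IsTensorSymbol e θ w n T) :
    tensorNorm g T =O[cobounded C2] w := by
  obtain ⟨f, hf, hTf⟩ := hT
  have hcomp (i : Fin k → Fin 4) :
      (fun z => T z fun a => orthoFrame (g z) (i a)) =O[cobounded C2] w := by
    have hterm (j : Fin k → Fin 4) :
        (fun z => (∏ a, θ (j a) z (orthoFrame (g z) (i a))) • f j z) =O[cobounded C2] w := by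
      have hprod := IsBigO.finsetProd (s := Finset.univ) fun a _ =>
        H.coframe_orthoFrame_isBigO (j a) (i a)
      simpa using hprod.smul (hf j).isBigO
    refine (IsBigO.sum fun j (_ : j ∈ Finset.univ) => hterm j).congr' ?_ .rfl
    filter_upwards [hTf] with z hz
    rw [hz, Finset.sum_apply]
  refine .trans (.of_bound 1 (.of_forall fun z => ?_))
    (IsBigO.sum fun (i : Fin k → Fin 4) (_ : i ∈ Finset.univ) => (hcomp i).norm_left)
  have hnonneg : 0 ≤ ∑ i : Fin k → Fin 4, ‖T z fun a => orthoFrame (g z) (i a)‖ := by positivity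
  rw [one_mul, Finset.sum_apply, tensorNorm, Real.norm_of_nonneg (Real.sqrt_nonneg _),
    Real.norm_of_nonneg hnonneg]
  exact Real.sqrt_le_iff.2 ⟨hnonneg, Finset.sum_sq_le_sq_sum_of_nonneg fun _ _ => norm_nonneg _⟩

theorem isTensorSymbol_covDeriv (H : IsSymbolicFrame g e θ h)
    (hT : IsTensorSymbol e θ w (n + 1) T) : IsTensorSymbol e θ w n (covDeriv g T) := by
  obtain ⟨f, hf, hTf⟩ := hT
  refine IsTensorSymbol.congr (.sum fun i => .add
    (.sum fun a => .prod_coframe_smul (Fin.cons a i) ((hf i).frameDeriv a))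
    (.sum fun j => .sum fun a => .sum fun b =>
      .prod_coframe_smul (Fin.cons a (Function.update i j b))
        ((H.isSymbol_nablaCoframe a b (i j)).smul_left (hf i).pred))) ?_
  filter_upwards [H.eventually_isDiagonalFrameAt, eventually_cobounded_eventually_nhds hTf,
    eventually_all.2 fun i => (hf i).smooth.differentiableAt] with z hz hTz hfz
  ext Z
  rw [covDeriv_congr (hTz.mono fun w hw => funext hw),
    covDeriv_sum fun i X => (hz.hasFDerivAt_prod_coframe_smul i (hfz i) X).differentiableAt]
  exact Finset.sum_congr rfl fun i _ => (hz.covDeriv_prod_coframe_smul_eq_sum i (hfz i) Z).symm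

theorem isTensorSymbol_iterCovDeriv (H : IsSymbolicFrame g e θ h) (l : ℕ)
    (hT : IsTensorSymbol e θ w (n + l) T) : IsTensorSymbol e θ w n (iterCovDeriv g l T) := by
  induction l generalizing n with
  | zero => exact hT
  | succ l ih => exact H.isTensorSymbol_covDeriv (ih (by rwa [add_right_comm, add_assoc]))

theorem tensorNorm_iterCovDeriv_isBigO (H : IsSymbolicFrame g e θ h) (l : ℕ)
    (hT : IsTensorSymbol e θ w l T) : tensorNorm g (iterCovDeriv g l T) =O[cobounded C2] w :=
  H.tensorNorm_isBigO (H.isTensorSymbol_iterCovDeriv (n := 0) l (by rwa [zero_add]))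

theorem isSymbol_dOneForm_frame (H : IsSymbolicFrame g e θ h) {γ : C2 → C2 →L[ℝ] ℂ}
    (hγ : ∀ a, IsSymbol e w (n + 1) fun z => γ z (e a z)) (a b : Fin 4) :
    IsSymbol e w n fun z => dOneForm γ z (e a z) (e b z) := by
  refine (((hγ b).frameDeriv a).sub ((hγ a).frameDeriv b)).add
    (.sum Finset.univ fun c _ => (H.isSymbol_dOneForm c a b n).smul_left (hγ c).pred) |>.congr ?_
  filter_upwards [H.eventually_isDiagonalFrameAt,
    eventually_all.2 fun a => (hγ a).smooth.differentiableAt,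
    eventually_cobounded_eventually_nhds H.eventually_isDiagonalFrameAt] with z hz hγz hnear
  have hexp : γ =ᶠ[𝓝 z] fun u => ∑ c, (θ c u).smulRight (γ u (e c u)) := by
    filter_upwards [hnear] with u hu
    ext Z
    simpa using hu.map_eq_sum (γ u) Z
  rw [dOneForm_congr hexp, dOneForm_sum_smulRight hz.differentiableAt_coframe hγz]
  simp [hz.coframe_frame, Finset.sum_add_distrib, frameDeriv]

theorem isTensorSymbol_dOneForm (H : IsSymbolicFrame g e θ h) {γ : C2 → C2 →L[ℝ] ℂ}
    (hγ : ∀ a, IsSymbol e w (n + 1) fun z => γ z (e a z)) :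
    IsTensorSymbol (k := 2) e θ w n fun z Z => dOneForm γ z (Z 0) (Z 1) := by
  refine IsTensorSymbol.congr (.sum fun a => .sum fun b =>
    .prod_coframe_smul ![a, b] (H.isSymbol_dOneForm_frame hγ a b)) ?_
  filter_upwards [H.eventually_isDiagonalFrameAt] with z hz
  ext Z
  let B : C2 →ₗ[ℝ] C2 →ₗ[ℝ] ℂ := LinearMap.mk₂ ℝ (dOneForm γ z)
    (fun _ _ _ => by simp [dOneForm]; ring) (fun _ _ _ => by simp [dOneForm, mul_sub])
    (fun _ _ _ => by simp [dOneForm]; ring) (fun _ _ _ => by simp [dOneForm, mul_sub])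
  simpa [B] using (hz.bilin_eq_sum B (Z 0) (Z 1)).symm

end IsSymbolicFrame

/-! ### The functions `y₁` and `R` -/

theorem contDiff_of_implicit {E : Type*} [NormedAddCommGroup E] [NormedSpace ℝ E]
    [CompleteSpace E] {n : WithTop ℕ∞} (hn : n ≠ 0) {F : E × ℝ → ℝ} {φ : E → ℝ}
    (hF : ContDiff ℝ n F) (hφ : ∀ z t, F (z, t) = 0 ↔ t = φ z)
    (hd : ∀ z, deriv (fun t => F (z, t)) (φ z) ≠ 0) : ContDiff ℝ n φ := by
  refine contDiff_iff_contDiffAt.2 fun z₀ => ?_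
  set p : E × ℝ := (z₀, φ z₀)
  have hFp : ContDiffAt ℝ n F p := hF.contDiffAt
  set L := fderiv ℝ F p ∘L .inr ℝ E ℝ
  have hL : HasDerivAt (fun t => F (z₀, t)) (L 1) (φ z₀) := by
    have h := (hFp.differentiableAt hn).hasFDerivAt.comp (φ z₀)
      ((hasFDerivAt_const z₀ (φ z₀)).prodMk (hasFDerivAt_id _))
    exact h.hasDerivAt.congr_deriv (by simp [L])
  have hL0 : L 1 ≠ 0 := hL.deriv ▸ hd z₀
  have hinv : L.IsInvertible :=
    ⟨ContinuousLinearEquiv.unitsEquivAut ℝ (Units.mk0 (L 1) hL0), by ext; simp⟩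
  refine (hFp.contDiffAt_implicitFunction hn hinv).congr_of_eventuallyEq ?_
  filter_upwards [hFp.eventually_apply_implicitFunction hn hinv] with z hz
  exact ((hφ z _).1 (hz.trans ((hφ z₀ _).2 rfl))).symm

/-- The complex coordinates as real linear maps. -/
def coord (i : Fin 2) : C2 →L[ℝ] ℂ :=
  (EuclideanSpace.proj i : C2 →L[ℂ] ℂ).restrictScalars ℝ

@[simp]
theorem coord_apply (i : Fin 2) (z : C2) : coord i z = z i := rfl

theorem contDiff_norm_coord_sq (i : Fin 2) : ContDiff ℝ ∞ fun z : C2 => ‖z i‖ ^ 2 :=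
  (contDiff_norm_sq ℝ).comp (coord i).contDiff

theorem norm_sq_eq (z : C2) : ‖z‖ ^ 2 = ‖z 0‖ ^ 2 + ‖z 1‖ ^ 2 := by
  rw [EuclideanSpace.norm_sq_eq, Fin.sum_univ_two]

theorem eventually_ne_zero : ∀ᶠ z in cobounded C2, z ≠ 0 := by
  filter_upwards [tendsto_norm_cobounded_atTop.eventually_gt_atTop (0 : ℝ)] with z hz
  exact norm_pos_iff.1 hz

variable {m : ℝ}

theorem uv_fst_sq (hm : 0 < m) (z : C2) :
    (uv m z).1 ^ 2 = Real.exp (-(4 * m * y₁ m z)) * ‖z 0‖ ^ 2 := by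
  rw [(isUV_uv hm z).2.2.1, mul_pow, ← mul_assoc, ← Real.exp_nat_mul, ← Real.exp_add, y₁,
    show -(4 * m * (((uv m z).1 ^ 2 - (uv m z).2 ^ 2) / 2))
      + (2 : ℕ) * (m * ((uv m z).1 ^ 2 - (uv m z).2 ^ 2)) = 0 by push_cast; ring,
    Real.exp_zero, one_mul]

theorem uv_snd_sq (hm : 0 < m) (z : C2) :
    (uv m z).2 ^ 2 = Real.exp (4 * m * y₁ m z) * ‖z 1‖ ^ 2 := by
  rw [(isUV_uv hm z).2.2.2, mul_pow, ← mul_assoc, ← Real.exp_nat_mul, ← Real.exp_add, y₁,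
    show 4 * m * (((uv m z).1 ^ 2 - (uv m z).2 ^ 2) / 2)
      + (2 : ℕ) * (m * ((uv m z).2 ^ 2 - (uv m z).1 ^ 2)) = 0 by push_cast; ring,
    Real.exp_zero, one_mul]

theorem exp_neg_mul_norm_sq (hm : 0 < m) (z : C2) :
    Real.exp (-(4 * m * y₁ m z)) * ‖z 0‖ ^ 2 = R m z + y₁ m z := by
  rw [← uv_fst_sq hm, R, y₁]
  ring

theorem exp_mul_norm_sq (hm : 0 < m) (z : C2) :
    Real.exp (4 * m * y₁ m z) * ‖z 1‖ ^ 2 = R m z - y₁ m z := by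
  rw [← uv_snd_sq hm, R, y₁]
  ring

theorem norm_sq_coord_zero (hm : 0 < m) (z : C2) :
    ‖z 0‖ ^ 2 = Real.exp (4 * m * y₁ m z) * (R m z + y₁ m z) := by
  rw [← exp_neg_mul_norm_sq hm, ← mul_assoc, ← Real.exp_add]
  simp

theorem norm_sq_coord_one (hm : 0 < m) (z : C2) :
    ‖z 1‖ ^ 2 = Real.exp (-(4 * m * y₁ m z)) * (R m z - y₁ m z) := by
  rw [← exp_mul_norm_sq hm, ← mul_assoc, ← Real.exp_add]
  simp

/-- The function `t ↦ 2t - e^{-4mt} |z₁|² + e^{4mt} |z₂|²`, whose only zero is `y₁`. -/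
def y₁Equation (m : ℝ) (z : C2) (t : ℝ) : ℝ :=
  2 * t - Real.exp (-(4 * m * t)) * ‖z 0‖ ^ 2 + Real.exp (4 * m * t) * ‖z 1‖ ^ 2

theorem deriv_y₁Equation_pos (hm : 0 < m) (z : C2) (t : ℝ) : 0 < deriv (y₁Equation m z) t := by
  have hlin := (hasDerivAt_id t).const_mul (4 * m)
  have h : HasDerivAt (y₁Equation m z) _ t :=
    (((hasDerivAt_id t).const_mul 2).sub (hlin.neg.exp.mul_const (‖z 0‖ ^ 2))).add
      (hlin.exp.mul_const (‖z 1‖ ^ 2))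
  rw [h.deriv]
  simp only [mul_one, mul_neg, neg_mul, sub_neg_eq_add]
  positivity

theorem y₁Equation_eq_zero_iff (hm : 0 < m) (z : C2) (t : ℝ) :
    y₁Equation m z t = 0 ↔ t = y₁ m z := by
  have hzero : y₁Equation m z (y₁ m z) = 0 := by
    rw [y₁Equation, exp_neg_mul_norm_sq hm, exp_mul_norm_sq hm]
    ring
  rw [← hzero, (strictMono_of_deriv_pos (deriv_y₁Equation_pos hm z)).injective.eq_iff]

theorem contDiff_y₁ (hm : 0 < m) : ContDiff ℝ ∞ (y₁ m) := by
  have hF : ContDiff ℝ ∞ fun p : C2 × ℝ => y₁Equation m p.1 p.2 :=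
    ((contDiff_const.mul contDiff_snd).sub
      ((Real.contDiff_exp.comp (contDiff_const.mul contDiff_snd).neg).mul
        ((contDiff_norm_coord_sq 0).comp contDiff_fst))).add
      ((Real.contDiff_exp.comp (contDiff_const.mul contDiff_snd)).mul
        ((contDiff_norm_coord_sq 1).comp contDiff_fst))
  exact contDiff_of_implicit (by simp) hF (y₁Equation_eq_zero_iff hm)
    fun z => (deriv_y₁Equation_pos hm z _).ne'

theorem R_eq (hm : 0 < m) : R m = fun z => (Real.exp (-(4 * m * y₁ m z)) * ‖z 0‖ ^ 2
      + Real.exp (4 * m * y₁ m z) * ‖z 1‖ ^ 2) / 2 := by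
  funext z
  rw [exp_neg_mul_norm_sq hm, exp_mul_norm_sq hm]
  ring

theorem contDiff_R (hm : 0 < m) : ContDiff ℝ ∞ (R m) := by
  rw [R_eq hm]
  have h := contDiff_const.mul (contDiff_y₁ hm) (f := fun _ => 4 * m)
  exact (((Real.contDiff_exp.comp h.neg).mul (contDiff_norm_coord_sq 0)).add
    ((Real.contDiff_exp.comp h).mul (contDiff_norm_coord_sq 1))).div_const 2

theorem R_nonneg (z : C2) : 0 ≤ R m z := by
  rw [R]
  positivity

theorem abs_y₁_le_R (z : C2) : |y₁ m z| ≤ R m z := by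
  rw [abs_le, y₁, R]
  constructor <;> nlinarith [sq_nonneg (uv m z).1, sq_nonneg (uv m z).2]

theorem R_pos (hm : 0 < m) {z : C2} (hz : z ≠ 0) : 0 < R m z := by
  refine (R_nonneg z).lt_of_ne' fun hR => hz (norm_eq_zero.1 (sq_eq_zero_iff.1 ?_))
  have hy : y₁ m z = 0 := abs_nonpos_iff.1 (hR ▸ abs_y₁_le_R z)
  rw [norm_sq_eq, norm_sq_coord_zero hm, norm_sq_coord_one hm, hR, hy]
  ring

theorem norm_yC_sq (z : C2) : ‖yC z‖ ^ 2 = ‖z 0‖ ^ 2 * ‖z 1‖ ^ 2 := by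
  simp [yC, mul_pow]

theorem R_sq (hm : 0 < m) (z : C2) : R m z ^ 2 = y₁ m z ^ 2 + ‖yC z‖ ^ 2 := by
  have hexp : Real.exp (4 * m * y₁ m z) * Real.exp (-(4 * m * y₁ m z)) = 1 := by
    rw [← Real.exp_add, add_neg_cancel, Real.exp_zero]
  rw [norm_yC_sq, norm_sq_coord_zero hm, norm_sq_coord_one hm]
  linear_combination (-(R m z ^ 2 - y₁ m z ^ 2)) * hexp

theorem norm_yC_le_R (hm : 0 < m) (z : C2) : ‖yC z‖ ≤ R m z :=
  le_of_sq_le_sq (by nlinarith [R_sq hm z, sq_nonneg (y₁ m z)]) (R_nonneg z)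

theorem norm_sq_eq_cosh_sinh (hm : 0 < m) (z : C2) :
    ‖z‖ ^ 2 = 2 * (R m z * Real.cosh (4 * m * y₁ m z) + y₁ m z * Real.sinh (4 * m * y₁ m z)) := by
  rw [norm_sq_eq, norm_sq_coord_zero hm, norm_sq_coord_one hm, Real.cosh_eq, Real.sinh_eq]
  ring

theorem mul_sinh_nonneg (hm : 0 < m) (t : ℝ) : 0 ≤ t * Real.sinh (4 * m * t) := by
  rcases le_total 0 t with h | h
  · exact mul_nonneg h (Real.sinh_nonneg_iff.2 (by positivity))
  · exact mul_nonneg_of_nonpos_of_nonpos h (Real.sinh_nonpos_iff.2 (by nlinarith))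

theorem two_mul_R_le_norm_sq (hm : 0 < m) (z : C2) : 2 * R m z ≤ ‖z‖ ^ 2 := by
  rw [norm_sq_eq_cosh_sinh hm]
  nlinarith [mul_sinh_nonneg hm (y₁ m z), Real.one_le_cosh (4 * m * y₁ m z),
    R_nonneg (m := m) z]

theorem norm_sq_le_of_R_le_one (hm : 0 < m) {z : C2} (hR : R m z ≤ 1) :
    ‖z‖ ^ 2 ≤ 4 * Real.exp (4 * m) := by
  obtain ⟨hy, hy'⟩ := abs_le.1 (abs_y₁_le_R (m := m) z)
  have hexp : Real.exp (4 * m * y₁ m z) ≤ Real.exp (4 * m) := Real.exp_le_exp.2 (by nlinarith)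
  have hexp' : Real.exp (-(4 * m * y₁ m z)) ≤ Real.exp (4 * m) :=
    Real.exp_le_exp.2 (by nlinarith)
  have h0 : ‖z 0‖ ^ 2 ≤ Real.exp (4 * m) * 2 := by
    rw [norm_sq_coord_zero hm]
    exact mul_le_mul hexp (by linarith) (by linarith) (Real.exp_pos _).le
  have h1 : ‖z 1‖ ^ 2 ≤ Real.exp (4 * m) * 2 := by
    rw [norm_sq_coord_one hm]
    exact mul_le_mul hexp' (by linarith) (by linarith) (Real.exp_pos _).le
  linarith [norm_sq_eq z]

theorem eventually_one_le_R (hm : 0 < m) : ∀ᶠ z in cobounded C2, 1 ≤ R m z := by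
  have hsq : Tendsto (fun z : C2 => ‖z‖ ^ 2) (cobounded C2) atTop :=
    (tendsto_pow_atTop two_ne_zero).comp tendsto_norm_cobounded_atTop
  filter_upwards [hsq.eventually_gt_atTop (4 * Real.exp (4 * m))] with z hz
  exact (not_le.1 fun hR => (norm_sq_le_of_R_le_one hm hR).not_gt hz).le

/-! ### The frame and its dual coframe -/

/-- The complex symplectic form `dz₁ ∧ dz₂`. -/
def symp : C2 →L[ℝ] C2 →L[ℝ] ℂ :=
  (ContinuousLinearMap.mul ℝ ℂ).bilinearComp (coord 0) (coord 1)
    - (ContinuousLinearMap.mul ℝ ℂ).bilinearComp (coord 1) (coord 0)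

@[simp]
theorem symp_apply (Z W : C2) : symp Z W = Z 0 * W 1 - Z 1 * W 0 := rfl

/-- The linear vector field `N = (z₁, -z₂)`, which generates the hyperbolic flow
`(e^t z₁, e^{-t} z₂)`. -/
def axial : C2 →L[ℝ] C2 :=
  LinearMap.toContinuousLinearMap
    { toFun := fun z => !₂[z 0, -z 1]
      map_add' := by
        intro x y; ext i; fin_cases i <;> simp; ring
      map_smul' := by
        intro c x; ext i; fin_cases i <;> simp }

@[simp]
theorem axial_zero (z : C2) : axial z 0 = z 0 := rfl

@[simp]
theorem axial_one (z : C2) : axial z 1 = -z 1 := rfl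

/-- The antilinear map `z ↦ (i conj z₂, 0)`. -/
def conjSwapFst : C2 →L[ℝ] C2 :=
  LinearMap.toContinuousLinearMap
    { toFun := fun z => !₂[Complex.I * starRingEnd ℂ (z 1), 0]
      map_add' := by
        intro x y; ext i; fin_cases i <;> simp; ring
      map_smul' := by
        intro c x; ext i; fin_cases i <;> simp; ring }

/-- The antilinear map `z ↦ (0, i conj z₁)`. -/
def conjSwapSnd : C2 →L[ℝ] C2 :=
  LinearMap.toContinuousLinearMap
    { toFun := fun z => !₂[0, Complex.I * starRingEnd ℂ (z 0)]
      map_add' := by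
        intro x y; ext i; fin_cases i <;> simp; ring
      map_smul' := by
        intro c x; ext i; fin_cases i <;> simp; ring }

@[simp]
theorem conjSwapFst_zero (z : C2) : conjSwapFst z 0 = Complex.I * starRingEnd ℂ (z 1) := rfl

@[simp]
theorem conjSwapFst_one (z : C2) : conjSwapFst z 1 = 0 := rfl

@[simp]
theorem conjSwapSnd_zero (z : C2) : conjSwapSnd z 0 = 0 := rfl

@[simp]
theorem conjSwapSnd_one (z : C2) : conjSwapSnd z 1 = Complex.I * starRingEnd ℂ (z 0) := rfl

theorem stdI_zero_apply (z : C2) : stdI 0 z = Complex.I • z := by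
  ext i
  fin_cases i <;> rfl

/-- The antilinear map `Z ↦ (i / 2R) (e^{4my₁} conj Z₂, e^{-4my₁} conj Z₁)`, with `R` and `y₁`
evaluated at `z`. -/
def conjLift (m : ℝ) (z : C2) : C2 →L[ℝ] C2 :=
  (2 * R m z)⁻¹ • (Real.exp (4 * m * y₁ m z) • conjSwapFst
    + Real.exp (-(4 * m * y₁ m z)) • conjSwapSnd)

theorem conjLift_zero (m : ℝ) (z Z : C2) :
    conjLift m z Z 0 = (2 * R m z : ℂ)⁻¹ * (Real.exp (4 * m * y₁ m z) *
      (Complex.I * starRingEnd ℂ (Z 1))) := by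
  simp [conjLift]

theorem conjLift_one (m : ℝ) (z Z : C2) :
    conjLift m z Z 1 = (2 * R m z : ℂ)⁻¹ * (Real.exp (-(4 * m * y₁ m z)) *
      (Complex.I * starRingEnd ℂ (Z 0))) := by
  simp [conjLift]

theorem conjLift_I (m : ℝ) (z Z : C2) :
    conjLift m z (stdI 0 Z) = -stdI 0 (conjLift m z Z) := by
  ext i
  fin_cases i
  · simp [stdI_zero_apply, conjLift_zero]
    ring
  · simp [stdI_zero_apply, conjLift_one]
    ring

theorem conjLift_axial (m : ℝ) (z Z : C2) :
    conjLift m z (axial Z) = -axial (conjLift m z Z) := by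
  ext i
  fin_cases i <;> simp [conjLift_zero, conjLift_one]

theorem conjLift_conjLift (m : ℝ) (z Z : C2) :
    conjLift m z (conjLift m z Z) = ((R m z)⁻¹ ^ 2 / 4) • Z := by
  have hexp : (Real.exp (4 * m * y₁ m z) : ℂ) * Real.exp (-(4 * m * y₁ m z)) = 1 := by
    rw [← Complex.ofReal_mul, ← Real.exp_add, add_neg_cancel, Real.exp_zero, Complex.ofReal_one]
  ext i
  fin_cases i
  · simp only [Fin.zero_eta, conjLift_zero, conjLift_one, PiLp.smul_apply, Complex.real_smul,
      map_mul, Complex.conj_I, Complex.conj_ofReal, Complex.conj_conj, map_inv₀, map_ofNat]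
    push_cast at hexp ⊢
    rw [mul_inv]
    linear_combination ((R m z : ℂ)⁻¹ ^ 2 / 4 * Z 0) * hexp - ((R m z : ℂ)⁻¹ ^ 2 / 4 * Z 0) *
      Complex.exp (4 * m * y₁ m z) * Complex.exp (-(4 * m * y₁ m z)) * Complex.I_sq
  · simp only [Fin.mk_one, conjLift_zero, conjLift_one, PiLp.smul_apply, Complex.real_smul,
      map_mul, Complex.conj_I, Complex.conj_ofReal, Complex.conj_conj, map_inv₀, map_ofNat]
    push_cast at hexp ⊢
    rw [mul_inv]
    linear_combination ((R m z : ℂ)⁻¹ ^ 2 / 4 * Z 1) * hexp - ((R m z : ℂ)⁻¹ ^ 2 / 4 * Z 1) *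
      Complex.exp (4 * m * y₁ m z) * Complex.exp (-(4 * m * y₁ m z)) * Complex.I_sq

/-- The horizontal lift `X = (i / 2R) (e^{4my₁} conj z₂, e^{-4my₁} conj z₁)` of `∂/∂y₂`. -/
def horiz (m : ℝ) (z : C2) : C2 := conjLift m z z

/-- The frame `N`, `I₁ N`, `X`, `I₁ X`. -/
def frame (m : ℝ) : Fin 4 → C2 → C2 :=
  ![fun z => axial z, fun z => stdI 0 (axial z), fun z => horiz m z, fun z => stdI 0 (horiz m z)]

/-- The `(1,0)`-form `α = V dy₁ + i η`. -/
def alpha (m : ℝ) (z : C2) : C2 →L[ℝ] ℂ := Complex.I • symp (horiz m z)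

/-- The `(1,0)`-form `β = dy₂ + i dy₃`. -/
def beta (z : C2) : C2 →L[ℝ] ℂ := -Complex.I • symp (axial z)

/-- The coframe `Re α`, `Im α`, `Re β`, `Im β` dual to `frame`. -/
def coframe (m : ℝ) : Fin 4 → C2 → C2 →L[ℝ] ℝ :=
  ![fun z => Complex.reCLM ∘L alpha m z, fun z => Complex.imCLM ∘L alpha m z,
    fun z => Complex.reCLM ∘L beta z, fun z => Complex.imCLM ∘L beta z]

theorem contDiffAt_horiz (hm : 0 < m) {z : C2} (hz : z ≠ 0) : ContDiffAt ℝ ∞ (horiz m) z := by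
  have hR : ContDiffAt ℝ ∞ (fun w => (2 * R m w)⁻¹) z :=
    (contDiffAt_const.mul (contDiff_R hm).contDiffAt).inv (by have := R_pos hm hz; positivity)
  have hy : ContDiffAt ℝ ∞ (fun w => 4 * m * y₁ m w) z :=
    contDiffAt_const.mul (contDiff_y₁ hm).contDiffAt
  exact (hR.smul (((Real.contDiff_exp.contDiffAt.comp z hy).smul contDiffAt_const).add
    ((Real.contDiff_exp.contDiffAt.comp z hy.neg).smul contDiffAt_const))).clm_apply contDiffAt_id

theorem contDiffAt_alpha (hm : 0 < m) {z : C2} (hz : z ≠ 0) : ContDiffAt ℝ ∞ (alpha m) z :=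
  (symp.contDiff.contDiffAt.comp z (contDiffAt_horiz hm hz)).const_smul _

theorem contDiff_beta : ContDiff ℝ ∞ beta :=
  (symp.comp axial).contDiff.const_smul (-Complex.I)

theorem contDiffAt_coframe (hm : 0 < m) {z : C2} (hz : z ≠ 0) (a : Fin 4) :
    ContDiffAt ℝ ∞ (coframe m a) z := by
  fin_cases a
  · exact contDiffAt_const.clm_comp (contDiffAt_alpha hm hz)
  · exact contDiffAt_const.clm_comp (contDiffAt_alpha hm hz)
  · exact contDiffAt_const.clm_comp contDiff_beta.contDiffAt
  · exact contDiffAt_const.clm_comp contDiff_beta.contDiffAt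

theorem alpha_eq_I_mul_symp (m : ℝ) (z Z : C2) :
    alpha m z Z = Complex.I * symp (horiz m z) Z := rfl

theorem alpha_apply (m : ℝ) (z Z : C2) :
    alpha m z Z = (2 * R m z : ℂ)⁻¹ * (Real.exp (-(4 * m * y₁ m z)) * (starRingEnd ℂ (z 0) * Z 0)
      - Real.exp (4 * m * y₁ m z) * (starRingEnd ℂ (z 1) * Z 1)) := by
  rw [alpha_eq_I_mul_symp, symp_apply, horiz, conjLift_zero, conjLift_one]
  linear_combination (2 * R m z : ℂ)⁻¹ * (Real.exp (4 * m * y₁ m z) * (starRingEnd ℂ (z 1) * Z 1)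
    - Real.exp (-(4 * m * y₁ m z)) * (starRingEnd ℂ (z 0) * Z 0)) * Complex.I_sq

theorem beta_eq_neg_I_mul_symp (z Z : C2) : beta z Z = -Complex.I * symp (axial z) Z := rfl

theorem beta_apply (z Z : C2) : beta z Z = -Complex.I * (z 0 * Z 1 + z 1 * Z 0) := by
  rw [beta_eq_neg_I_mul_symp, symp_apply, axial_zero, axial_one]
  ring

theorem exp_neg_mul_conj (hm : 0 < m) (z : C2) :
    (Real.exp (-(4 * m * y₁ m z)) : ℂ) * (starRingEnd ℂ (z 0) * z 0) = R m z + y₁ m z := by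
  rw [← Complex.normSq_eq_conj_mul_self, Complex.normSq_eq_norm_sq]
  exact_mod_cast exp_neg_mul_norm_sq hm z

theorem exp_mul_conj (hm : 0 < m) (z : C2) :
    (Real.exp (4 * m * y₁ m z) : ℂ) * (starRingEnd ℂ (z 1) * z 1) = R m z - y₁ m z := by
  rw [← Complex.normSq_eq_conj_mul_self, Complex.normSq_eq_norm_sq]
  exact_mod_cast exp_mul_norm_sq hm z

theorem symp_horiz_axial (hm : 0 < m) {z : C2} (hz : z ≠ 0) :
    symp (horiz m z) (axial z) = -Complex.I := by
  have hR : (R m z : ℂ) ≠ 0 := Complex.ofReal_ne_zero.2 (R_pos hm hz).ne'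
  rw [symp_apply, horiz, conjLift_zero, conjLift_one, axial_zero, axial_one]
  field_simp
  linear_combination -(exp_neg_mul_conj hm z + exp_mul_conj hm z)

theorem symp_swap (Z W : C2) : symp Z W = -symp W Z := by
  simp only [symp_apply]
  ring

theorem symp_self (Z : C2) : symp Z Z = 0 := by
  rw [symp_apply]
  ring

theorem alpha_axial (hm : 0 < m) {z : C2} (hz : z ≠ 0) : alpha m z (axial z) = 1 := by
  rw [alpha_eq_I_mul_symp, symp_horiz_axial hm hz]
  simp

theorem alpha_horiz (m : ℝ) (z : C2) : alpha m z (horiz m z) = 0 := by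
  rw [alpha_eq_I_mul_symp, symp_self, mul_zero]

theorem beta_axial (z : C2) : beta z (axial z) = 0 := by
  rw [beta_eq_neg_I_mul_symp, symp_self, mul_zero]

theorem beta_horiz (hm : 0 < m) {z : C2} (hz : z ≠ 0) : beta z (horiz m z) = 1 := by
  rw [beta_eq_neg_I_mul_symp, symp_swap, symp_horiz_axial hm hz]
  simp

theorem symp_I_left (Z W : C2) : symp (stdI 0 Z) W = Complex.I * symp Z W := by
  simp only [symp_apply, stdI_zero_apply, PiLp.smul_apply, smul_eq_mul]
  ring

theorem symp_I_right (Z W : C2) : symp Z (stdI 0 W) = Complex.I * symp Z W := by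
  rw [symp_swap, symp_I_left, symp_swap W]
  ring

theorem alpha_I (m : ℝ) (z Z : C2) : alpha m z (stdI 0 Z) = Complex.I * alpha m z Z := by
  rw [alpha_eq_I_mul_symp, alpha_eq_I_mul_symp, symp_I_right]

theorem beta_I (z Z : C2) : beta z (stdI 0 Z) = Complex.I * beta z Z := by
  rw [beta_eq_neg_I_mul_symp, beta_eq_neg_I_mul_symp, symp_I_right]
  ring

theorem alpha_frame (hm : 0 < m) {z : C2} (hz : z ≠ 0) (a : Fin 4) :
    alpha m z (frame m a z) = ![1, Complex.I, 0, 0] a := by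
  fin_cases a <;> simp [frame, alpha_I, alpha_axial hm hz, alpha_horiz]

theorem beta_frame (hm : 0 < m) {z : C2} (hz : z ≠ 0) (a : Fin 4) :
    beta z (frame m a z) = ![0, 0, 1, Complex.I] a := by
  fin_cases a <;> simp [frame, beta_I, beta_axial, beta_horiz hm hz]

theorem coframe_frame (hm : 0 < m) {z : C2} (hz : z ≠ 0) (a b : Fin 4) :
    coframe m a z (frame m b z) = if a = b then 1 else 0 := by
  have hα := alpha_frame hm hz b
  have hβ := beta_frame hm hz b
  fin_cases a <;> simp only [coframe, Matrix.cons_val_zero, Matrix.cons_val_one, Matrix.cons_val,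
    Fin.zero_eta, Fin.mk_one, Fin.reduceFinMk, ContinuousLinearMap.comp_apply, hα, hβ] <;>
    fin_cases b <;> simp

/-! ### First derivatives and the metric in the frame -/

theorem V_eq (hm : 0 < m) {z : C2} (hz : z ≠ 0) : V m z = 2 * m + (R m z)⁻¹ / 2 := by
  have hR := (R_pos hm hz).ne'
  rw [V]
  field_simp
  ring

theorem V_pos (hm : 0 < m) {z : C2} (hz : z ≠ 0) : 0 < V m z := by
  have hR := R_pos hm hz
  rw [V]
  positivity

theorem contDiffAt_V (hm : 0 < m) {z : C2} (hz : z ≠ 0) : ContDiffAt ℝ ∞ (V m) z := by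
  have hR := (contDiff_R hm).contDiffAt (x := z)
  exact (contDiffAt_const.add (contDiffAt_const.mul hR)).div (contDiffAt_const.mul hR)
    (by have := R_pos hm hz; positivity)

theorem hasFDerivAt_norm_coord_sq (i : Fin 2) (z : C2) :
    HasFDerivAt (fun w : C2 => ‖w i‖ ^ 2) (2 • (innerSL ℝ (z i)).comp (coord i)) z :=
  (coord i).hasFDerivAt.norm_sq

theorem re_alpha (m : ℝ) (z Z : C2) :
    (alpha m z Z).re = (2 * R m z)⁻¹ * (Real.exp (-(4 * m * y₁ m z)) *
      (starRingEnd ℂ (z 0) * Z 0).re - Real.exp (4 * m * y₁ m z) *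
      (starRingEnd ℂ (z 1) * Z 1).re) := by
  rw [alpha_apply]
  norm_cast
  rw [Complex.re_ofReal_mul, Complex.sub_re, Complex.re_ofReal_mul, Complex.re_ofReal_mul]

theorem hasFDerivAt_y₁ (hm : 0 < m) {z : C2} (hz : z ≠ 0) :
    HasFDerivAt (y₁ m) ((V m z)⁻¹ • (Complex.reCLM ∘L alpha m z)) z := by
  have hR := R_pos hm hz
  have hy := ((contDiff_y₁ hm).differentiable (by simp) z).hasFDerivAt
  have hay := hy.const_mul (4 * m)
  have hrhs := (hay.fun_neg.exp.mul (hasFDerivAt_norm_coord_sq 0 z)).sub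
    (hay.exp.mul (hasFDerivAt_norm_coord_sq 1 z))
  have heq : (fun w => 2 * y₁ m w) = fun w => Real.exp (-(4 * m * y₁ m w)) * ‖w 0‖ ^ 2
      - Real.exp (4 * m * y₁ m w) * ‖w 1‖ ^ 2 := by
    funext w
    rw [exp_neg_mul_norm_sq hm, exp_mul_norm_sq hm]
    ring
  have hunique := (heq ▸ hy.const_mul 2).unique hrhs
  refine hy.congr_fderiv (ContinuousLinearMap.ext fun Z => ?_)
  have hZ := congrArg (fun L : C2 →L[ℝ] ℝ => L Z) hunique
  simp only [smul_apply, smul_eq_mul, sub_apply, add_apply, neg_apply,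
    ContinuousLinearMap.comp_apply, innerSL_apply_apply, coord_apply, Complex.inner, nsmul_eq_mul,
    Nat.cast_ofNat, mul_comm (Z _)] at hZ
  rw [smul_apply, ContinuousLinearMap.comp_apply, Complex.reCLM_apply, re_alpha, V]
  simp only [smul_eq_mul]
  field_simp
  linear_combination hZ / 2 - 2 * m * fderiv ℝ (y₁ m) z Z *
    (exp_neg_mul_norm_sq hm z + exp_mul_norm_sq hm z)

theorem fderiv_y₁ (hm : 0 < m) {z : C2} (hz : z ≠ 0) (Z : C2) :
    fderiv ℝ (y₁ m) z Z = (V m z)⁻¹ * (alpha m z Z).re := by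
  rw [(hasFDerivAt_y₁ hm hz).fderiv]
  rfl

theorem contDiff_yC : ContDiff ℝ ∞ yC :=
  contDiff_const.mul ((coord 0).contDiff.mul (coord 1).contDiff)

theorem hasFDerivAt_yC (z : C2) : HasFDerivAt yC (beta z) z := by
  have h := (((coord 0).hasFDerivAt (x := z)).mul ((coord 1).hasFDerivAt (x := z))).const_mul
    (-Complex.I)
  refine h.congr_fderiv ?_
  ext Z
  rw [beta_apply]
  simp
  ring

theorem fderiv_R (hm : 0 < m) {z : C2} (hz : z ≠ 0) (Z : C2) :
    fderiv ℝ (R m) z Z = (R m z)⁻¹ * (y₁ m z * fderiv ℝ (y₁ m) z Z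
      + (starRingEnd ℂ (yC z) * beta z Z).re) := by
  have hR := R_pos hm hz
  have hy := ((contDiff_y₁ hm).differentiable (by simp) z).hasFDerivAt
  have hlhs : HasFDerivAt (fun w => R m w ^ 2) _ z :=
    ((contDiff_R hm).differentiable (by simp) z).hasFDerivAt.pow 2
  have hrhs := (hy.pow 2).add (hasFDerivAt_yC z).norm_sq
  have heq : (fun w => R m w ^ 2) = fun w => y₁ m w ^ 2 + ‖yC w‖ ^ 2 :=
    funext fun w => R_sq hm w
  have hZ := congrArg (fun L : C2 →L[ℝ] ℝ => L Z) ((heq ▸ hlhs).unique hrhs)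
  simp only [smul_apply, smul_eq_mul, add_apply, ContinuousLinearMap.comp_apply,
    innerSL_apply_apply, Complex.inner, nsmul_eq_mul, Nat.cast_ofNat, Nat.add_one_sub_one,
    pow_one, mul_comm (beta z Z)] at hZ
  field_simp
  linear_combination hZ / 2

theorem eta_eq (hm : 0 < m) {z : C2} (hz : z ≠ 0) (Z : C2) : eta m z Z = (alpha m z Z).im := by
  have hV := (V_pos hm hz).ne'
  rw [eta, fderiv_y₁ hm hz, alpha_I]
  simp only [Complex.mul_re, Complex.I_re, Complex.I_im]
  field_simp
  ring

/-- The diagonal entries of the metric in the frame. -/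
def metricDiag (m : ℝ) : Fin 4 → C2 → ℝ :=
  ![fun z => (V m z)⁻¹, fun z => (V m z)⁻¹, V m, V m]

theorem metric_eq_sum (hm : 0 < m) {z : C2} (hz : z ≠ 0) (Z W : C2) :
    metric m z Z W = ∑ a, metricDiag m a z * (coframe m a z Z * coframe m a z W) := by
  have hV := (V_pos hm hz).ne'
  have hy₁ (U : C2) : fderiv ℝ (y m 0) z U = (V m z)⁻¹ * (alpha m z U).re := fderiv_y₁ hm hz U
  have hy₂ (U : C2) : fderiv ℝ (y m 1) z U = (beta z U).re := by
    rw [show fderiv ℝ (y m 1) z = Complex.reCLM ∘L beta z from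
      (Complex.reCLM.hasFDerivAt.comp z (hasFDerivAt_yC z)).fderiv]
    rfl
  have hy₃ (U : C2) : fderiv ℝ (y m 2) z U = (beta z U).im := by
    rw [show fderiv ℝ (y m 2) z = Complex.imCLM ∘L beta z from
      (Complex.imCLM.hasFDerivAt.comp z (hasFDerivAt_yC z)).fderiv]
    rfl
  rw [metric, Fin.sum_univ_three, Fin.sum_univ_four]
  simp only [hy₁, hy₂, hy₃, eta_eq hm hz, metricDiag, coframe, Matrix.cons_val_zero,
    Matrix.cons_val_one, Matrix.cons_val, ContinuousLinearMap.comp_apply, Complex.reCLM_apply,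
    Complex.imCLM_apply]
  field_simp
  ring

theorem metricDiag_pos (hm : 0 < m) {z : C2} (hz : z ≠ 0) (a : Fin 4) : 0 < metricDiag m a z := by
  have hV := V_pos hm hz
  fin_cases a
  exacts [inv_pos.2 hV, inv_pos.2 hV, hV, hV]

theorem contDiffAt_metricDiag (hm : 0 < m) {z : C2} (hz : z ≠ 0) (a : Fin 4) :
    ContDiffAt ℝ ∞ (metricDiag m a) z := by
  have hV := contDiffAt_V hm hz
  have hV0 := (V_pos hm hz).ne'
  fin_cases a
  exacts [hV.inv hV0, hV.inv hV0, hV, hV]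

/-- The derivatives of `y₁` along the frame. -/
def dy₁ (m : ℝ) (a : Fin 4) (z : C2) : ℝ := ![(V m z)⁻¹, 0, 0, 0] a

/-- The derivatives of `y₂ + i y₃` along the frame. -/
def dyC (a : Fin 4) : ℂ := ![0, 0, 1, Complex.I] a

/-- The function `1 / R`. -/
def invR (m : ℝ) (z : C2) : ℝ := (R m z)⁻¹

/-- The first component `y₁ / R` of the direction of `y`. -/
def dirY (m : ℝ) (z : C2) : ℝ := invR m z * y₁ m z

/-- The complex component `(y₂ + i y₃) / R` of the direction of `y`. -/
def dirC (m : ℝ) (z : C2) : ℂ := invR m z • yC z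

/-- The derivatives of `R` along the frame. -/
def dR (m : ℝ) (a : Fin 4) (z : C2) : ℝ :=
  dirY m z * dy₁ m a z + (starRingEnd ℂ (dirC m z) * dyC a).re

theorem frameDeriv_y₁ (hm : 0 < m) {z : C2} (hz : z ≠ 0) (a : Fin 4) :
    frameDeriv (frame m) a (y₁ m) z = dy₁ m a z := by
  rw [frameDeriv, fderiv_y₁ hm hz, alpha_frame hm hz]
  fin_cases a <;> simp [dy₁]

theorem frameDeriv_yC (hm : 0 < m) {z : C2} (hz : z ≠ 0) (a : Fin 4) :
    frameDeriv (frame m) a yC z = dyC a := by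
  rw [frameDeriv_eq (hasFDerivAt_yC z), beta_frame hm hz, dyC]

theorem frameDeriv_R (hm : 0 < m) {z : C2} (hz : z ≠ 0) (a : Fin 4) :
    frameDeriv (frame m) a (R m) z = dR m a z := by
  rw [frameDeriv, fderiv_R hm hz, beta_frame hm hz, ← frameDeriv, frameDeriv_y₁ hm hz, dR, dirY,
    dirC, Complex.real_smul, map_mul, Complex.conj_ofReal, mul_assoc (invR m z : ℂ),
    Complex.re_ofReal_mul, invR, dyC]
  ring

theorem hasFDerivAt_invR (hm : 0 < m) {z : C2} (hz : z ≠ 0) :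
    HasFDerivAt (invR m) (-(invR m z ^ 2) • fderiv ℝ (R m) z) z := by
  refine ((hasDerivAt_inv (R_pos hm hz).ne').comp_hasFDerivAt z
    ((contDiff_R hm).differentiable (by simp) z).hasFDerivAt).congr_fderiv ?_
  rw [invR, inv_pow]

theorem frameDeriv_invR (hm : 0 < m) {z : C2} (hz : z ≠ 0) (a : Fin 4) :
    frameDeriv (frame m) a (invR m) z = -(invR m z * (dR m a z * invR m z)) := by
  rw [← frameDeriv_R hm hz, frameDeriv_eq (hasFDerivAt_invR hm hz), frameDeriv, smul_apply,
    smul_eq_mul]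
  ring

theorem differentiableAt_dirY (hm : 0 < m) {z : C2} (hz : z ≠ 0) :
    DifferentiableAt ℝ (dirY m) z :=
  (hasFDerivAt_invR hm hz).differentiableAt.mul ((contDiff_y₁ hm).differentiable (by simp) z)

theorem frameDeriv_dirY (hm : 0 < m) {z : C2} (hz : z ≠ 0) (a : Fin 4) :
    frameDeriv (frame m) a (dirY m) z = invR m z * (dy₁ m a z - dR m a z * dirY m z) := by
  have hy := ((contDiff_y₁ hm).differentiable (by simp) z).hasFDerivAt
  have h : HasFDerivAt (dirY m) _ z := (hasFDerivAt_invR hm hz).mul hy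
  rw [← frameDeriv_R hm hz, ← frameDeriv_y₁ hm hz, frameDeriv_eq h, frameDeriv, frameDeriv]
  simp only [smul_apply, smul_eq_mul, add_apply, dirY]
  ring

theorem frameDeriv_dirC (hm : 0 < m) {z : C2} (hz : z ≠ 0) (a : Fin 4) :
    frameDeriv (frame m) a (dirC m) z = invR m z • (dyC a - dR m a z • dirC m z) := by
  have h : HasFDerivAt (dirC m) _ z := (hasFDerivAt_invR hm hz).smul (hasFDerivAt_yC z)
  rw [← frameDeriv_R hm hz, ← frameDeriv_yC hm hz, frameDeriv_eq h,
    frameDeriv_eq (hasFDerivAt_yC z), frameDeriv]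
  simp only [smul_apply, add_apply, dirC, ContinuousLinearMap.smulRight_apply, smul_eq_mul,
    Complex.real_smul]
  push_cast
  ring

/-! ### Symbols built from `1 / R`, `y / R` and `V` -/

theorem smoothAtInfinity_invR (hm : 0 < m) : SmoothAtInfinity (invR m) := by
  filter_upwards [eventually_ne_zero] with z hz
  exact (contDiff_R hm).contDiffAt.inv (R_pos hm hz).ne'

theorem smoothAtInfinity_dirY (hm : 0 < m) : SmoothAtInfinity (dirY m) :=
  (smoothAtInfinity_invR hm).mono fun _ hz => hz.mul (contDiff_y₁ hm).contDiffAt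

theorem smoothAtInfinity_dirC (hm : 0 < m) : SmoothAtInfinity (dirC m) :=
  (smoothAtInfinity_invR hm).mono fun _ hz => hz.smul contDiff_yC.contDiffAt

theorem invR_isBigO_one (hm : 0 < m) : invR m =O[cobounded C2] (fun _ => (1 : ℝ)) := by
  refine .of_bound 1 ?_
  filter_upwards [eventually_one_le_R hm] with z hz
  rw [invR, norm_inv, Real.norm_of_nonneg (by linarith)]
  simpa using inv_le_one_of_one_le₀ hz

theorem dirY_isBigO (hm : 0 < m) : dirY m =O[cobounded C2] (fun _ => (1 : ℝ)) := by
  refine .of_bound 1 ?_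
  filter_upwards [eventually_ne_zero] with z hz
  have hR := R_pos hm hz
  rw [dirY, invR, norm_mul, norm_inv, Real.norm_of_nonneg hR.le, inv_mul_le_iff₀ hR]
  simpa using abs_y₁_le_R (m := m) z

theorem dirC_isBigO (hm : 0 < m) : dirC m =O[cobounded C2] (fun _ => (1 : ℝ)) := by
  refine .of_bound 1 ?_
  filter_upwards [eventually_ne_zero] with z hz
  have hR := R_pos hm hz
  rw [dirC, invR, norm_smul, norm_inv, Real.norm_of_nonneg hR.le, inv_mul_le_iff₀ hR]
  simpa using norm_yC_le_R hm z

variable {n : ℕ}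

theorem isSymbol_V_of_invR (hm : 0 < m) (h : IsSymbol (frame m) (invR m) n (invR m)) :
    IsSymbol (frame m) (fun _ => 1) n (V m) := by
  refine ((IsSymbol.const (2 * m)).add
    ((h.weight (invR_isBigO_one hm)).const_mul (1 / 2))).congr ?_
  filter_upwards [eventually_ne_zero] with z hz
  rw [V_eq hm hz, invR]
  ring

theorem isSymbol_invV_of_invR (hm : 0 < m) (h : IsSymbol (frame m) (invR m) n (invR m)) :
    IsSymbol (frame m) (fun _ => 1) n (fun z => (V m z)⁻¹) := by
  refine (isSymbol_V_of_invR hm h).inv (c := 2 * m) (by positivity) ?_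
  filter_upwards [eventually_ne_zero] with z hz
  have hR : 0 < (R m z)⁻¹ / 2 := by have := R_pos hm hz; positivity
  rw [V_eq hm hz]
  linarith

theorem isSymbol_dy₁_of_invR (hm : 0 < m) (h : IsSymbol (frame m) (invR m) n (invR m))
    (a : Fin 4) : IsSymbol (frame m) (fun _ => 1) n (dy₁ m a) := by
  fin_cases a
  exacts [isSymbol_invV_of_invR hm h, .const 0, .const 0, .const 0]

theorem isSymbol_dR_of_invR (hm : 0 < m) (h : IsSymbol (frame m) (invR m) n (invR m))
    (hY : IsSymbol (frame m) (fun _ => 1) n (dirY m))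
    (hC : IsSymbol (frame m) (fun _ => 1) n (dirC m)) (a : Fin 4) :
    IsSymbol (frame m) (fun _ => 1) n (dR m a) :=
  (hY.mul_left (isSymbol_dy₁_of_invR hm h a)).add
    (((hC.clm_comp Complex.conjCLE.toContinuousLinearMap).mul_left
      (.const (dyC a))).clm_comp Complex.reCLM)

/- The derivatives of `1 / R` and `y / R` along the frame are polynomials in `V⁻¹` and these
functions, so their orders as symbols increase together. -/
theorem isSymbol_invR_dirY_dirC (hm : 0 < m) (n : ℕ) :
    IsSymbol (frame m) (invR m) n (invR m) ∧ IsSymbol (frame m) (fun _ => 1) n (dirY m) ∧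
      IsSymbol (frame m) (fun _ => 1) n (dirC m) := by
  have hsR := smoothAtInfinity_invR hm
  have hsY := smoothAtInfinity_dirY hm
  have hsC := smoothAtInfinity_dirC hm
  induction n with
  | zero => exact ⟨⟨hsR, isBigO_refl _ _⟩, ⟨hsY, dirY_isBigO hm⟩, ⟨hsC, dirC_isBigO hm⟩⟩
  | succ n ih =>
    obtain ⟨hR, hY, hC⟩ := ih
    have hR1 := hR.weight (invR_isBigO_one hm)
    have hdR := isSymbol_dR_of_invR hm hR hY hC
    have hdy := isSymbol_dy₁_of_invR hm hR
    refine ⟨.of_frameDeriv hsR (isBigO_refl _ _)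
        (fun a => (hR1.mul_left ((hdR a).mul_left hR)).neg) fun a => ?_,
      .of_frameDeriv hsY (dirY_isBigO hm)
        (fun a => hR1.mul_left ((hdy a).sub ((hdR a).mul_left hY))) fun a => ?_,
      .of_frameDeriv hsC (dirC_isBigO hm)
        (fun a => hR1.smul_left ((IsSymbol.const (dyC a)).sub ((hdR a).smul_left hC)))
        fun a => ?_⟩
    all_goals filter_upwards [eventually_ne_zero] with z hz
    exacts [(frameDeriv_invR hm hz a).symm, (frameDeriv_dirY hm hz a).symm,
      (frameDeriv_dirC hm hz a).symm]

theorem isSymbol_invR (hm : 0 < m) : IsSymbol (frame m) (invR m) n (invR m) :=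
  (isSymbol_invR_dirY_dirC hm n).1

theorem isSymbol_invR_one (hm : 0 < m) : IsSymbol (frame m) (fun _ => 1) n (invR m) :=
  (isSymbol_invR hm).weight (invR_isBigO_one hm)

theorem isSymbol_dirY (hm : 0 < m) : IsSymbol (frame m) (fun _ => 1) n (dirY m) :=
  (isSymbol_invR_dirY_dirC hm n).2.1

theorem isSymbol_dirC (hm : 0 < m) : IsSymbol (frame m) (fun _ => 1) n (dirC m) :=
  (isSymbol_invR_dirY_dirC hm n).2.2

theorem isSymbol_V (hm : 0 < m) : IsSymbol (frame m) (fun _ => 1) n (V m) :=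
  isSymbol_V_of_invR hm (isSymbol_invR hm)

theorem isSymbol_invV (hm : 0 < m) : IsSymbol (frame m) (fun _ => 1) n (fun z => (V m z)⁻¹) :=
  isSymbol_invV_of_invR hm (isSymbol_invR hm)

theorem isSymbol_dy₁ (hm : 0 < m) (a : Fin 4) : IsSymbol (frame m) (fun _ => 1) n (dy₁ m a) :=
  isSymbol_dy₁_of_invR hm (isSymbol_invR hm) a

theorem isSymbol_dR (hm : 0 < m) (a : Fin 4) : IsSymbol (frame m) (fun _ => 1) n (dR m a) :=
  isSymbol_dR_of_invR hm (isSymbol_invR hm) (isSymbol_dirY hm) (isSymbol_dirC hm) a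

/-! ### Derivatives of the frame -/

theorem axial_horiz (m : ℝ) (z : C2) :
    axial (horiz m z) = (2 * R m z)⁻¹ • (Real.exp (4 * m * y₁ m z) • conjSwapFst z
      - Real.exp (-(4 * m * y₁ m z)) • conjSwapSnd z) := by
  ext i
  fin_cases i <;> simp [horiz, conjLift]

theorem fderiv_horiz (hm : 0 < m) {z : C2} (hz : z ≠ 0) (Z : C2) :
    fderiv ℝ (horiz m) z Z = -(invR m z * fderiv ℝ (R m) z Z) • horiz m z
      + (4 * m * fderiv ℝ (y₁ m) z Z) • axial (horiz m z) + conjLift m z Z := by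
  have hy := (((contDiff_y₁ hm).differentiable (by simp) z).hasFDerivAt).const_mul (4 * m)
  have hhalf : (fun w => (2 * R m w)⁻¹) = fun w => 1 / 2 * invR m w :=
    funext fun w => by rw [invR, mul_inv, one_div]
  have hR := (hasFDerivAt_invR hm hz).const_mul (1 / 2)
  rw [← hhalf] at hR
  have hconj : HasFDerivAt (fun w => Real.exp (4 * m * y₁ m w) • conjSwapFst w
      + Real.exp (-(4 * m * y₁ m w)) • conjSwapSnd w) _ z :=
    (hy.exp.smul conjSwapFst.hasFDerivAt).add (hy.fun_neg.exp.smul conjSwapSnd.hasFDerivAt)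
  rw [(show HasFDerivAt (horiz m) _ z from (hR.smul hconj :)).fderiv, axial_horiz, horiz, conjLift]
  simp only [smul_apply, add_apply, neg_apply, ContinuousLinearMap.smulRight_apply, smul_eq_mul,
    congrFun hhalf z]
  module

theorem conjLift_frame (m : ℝ) (z : C2) (a : Fin 4) :
    conjLift m z (frame m a z) = ![-axial (horiz m z), stdI 0 (axial (horiz m z)),
      (invR m z ^ 2 / 4) • z, -((invR m z ^ 2 / 4) • stdI 0 z)] a := by
  fin_cases a <;> simp [frame, horiz, invR, conjLift_I, conjLift_axial, conjLift_conjLift]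

theorem frameDeriv_horiz (hm : 0 < m) {z : C2} (hz : z ≠ 0) (a : Fin 4) :
    frameDeriv (frame m) a (horiz m) z = -((invR m z * dR m a z) • horiz m z)
      + (4 * m * dy₁ m a z) • axial (horiz m z) + conjLift m z (frame m a z) := by
  rw [← frameDeriv_R hm hz, ← frameDeriv_y₁ hm hz, frameDeriv, fderiv_horiz hm hz, frameDeriv,
    frameDeriv, neg_smul]

theorem norm_horiz_sq (hm : 0 < m) (z : C2) :
    ‖horiz m z‖ ^ 2 = (2 * R m z)⁻¹ ^ 2 *
      (2 * (R m z * Real.cosh (4 * m * y₁ m z) - y₁ m z * Real.sinh (4 * m * y₁ m z))) := by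
  have hexp : Real.exp (4 * m * y₁ m z) * Real.exp (-(4 * m * y₁ m z)) = 1 := by
    rw [← Real.exp_add, add_neg_cancel, Real.exp_zero]
  have hfst := norm_sq_coord_zero hm z
  have hsnd := norm_sq_coord_one hm z
  rw [norm_sq_eq, horiz, conjLift_zero, conjLift_one]
  simp only [norm_mul, norm_inv, Complex.norm_real, Complex.norm_I, RCLike.norm_conj, mul_pow,
    Complex.norm_ofNat, Real.norm_eq_abs, Real.abs_exp, abs_of_nonneg (R_nonneg z), hfst, hsnd,
    Real.cosh_eq, Real.sinh_eq, mul_inv]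
  linear_combination ((2⁻¹ * (R m z)⁻¹) ^ 2 * (Real.exp (4 * m * y₁ m z) * (R m z - y₁ m z)
    + Real.exp (-(4 * m * y₁ m z)) * (R m z + y₁ m z))) * hexp

theorem horiz_isBigO (hm : 0 < m) : horiz m =O[cobounded C2] fun z => ‖z‖ := by
  refine .of_bound 1 ?_
  filter_upwards [eventually_one_le_R hm] with z hz
  have hinv : (2 * R m z)⁻¹ ^ 2 ≤ 1 :=
    pow_le_one₀ (by positivity) (inv_le_one_of_one_le₀ (by linarith))
  rw [one_mul, norm_norm]
  refine le_of_sq_le_sq ?_ (norm_nonneg z)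
  calc ‖horiz m z‖ ^ 2
      ≤ (2 * R m z)⁻¹ ^ 2 * ‖z‖ ^ 2 := by
        rw [norm_horiz_sq hm, norm_sq_eq_cosh_sinh hm]
        gcongr
        linarith [mul_sinh_nonneg hm (y₁ m z)]
    _ ≤ ‖z‖ ^ 2 := mul_le_of_le_one_left (sq_nonneg _) hinv

theorem isSymbol_conjLift_frame (hm : 0 < m) (hid : IsSymbol (frame m) (‖·‖) n fun z : C2 => z)
    (hX : IsSymbol (frame m) (‖·‖) n (horiz m)) (a : Fin 4) :
    IsSymbol (frame m) (‖·‖) n fun z => conjLift m z (frame m a z) := by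
  have hR : IsSymbol (frame m) (fun _ => 1) n fun z => invR m z ^ 2 / 4 := by
    simpa only [div_eq_inv_mul, sq] using
      ((isSymbol_invR_one hm).mul_left (isSymbol_invR_one hm)).const_mul (4⁻¹)
  simp only [conjLift_frame]
  fin_cases a
  exacts [(hX.clm_comp axial).neg, (hX.clm_comp axial).clm_comp (stdI 0), hR.smul_left hid,
    (hR.smul_left (hid.clm_comp (stdI 0))).neg]

theorem isSymbol_frame_of_horiz (hid : IsSymbol (frame m) (‖·‖) n fun z : C2 => z)
    (hX : IsSymbol (frame m) (‖·‖) n (horiz m)) (a : Fin 4) :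
    IsSymbol (frame m) (‖·‖) n (frame m a) := by
  fin_cases a
  exacts [hid.clm_comp axial, (hid.clm_comp axial).clm_comp (stdI 0), hX, hX.clm_comp (stdI 0)]

theorem isSymbol_id_horiz (hm : 0 < m) (n : ℕ) :
    IsSymbol (frame m) (‖·‖) n (fun z : C2 => z) ∧ IsSymbol (frame m) (‖·‖) n (horiz m) := by
  have hsid : SmoothAtInfinity fun z : C2 => z := .of_forall fun _ => contDiffAt_id
  have hsX : SmoothAtInfinity (horiz m) := by
    filter_upwards [eventually_ne_zero] with z hz using contDiffAt_horiz hm hz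
  have hOid : (fun z : C2 => z) =O[cobounded C2] (‖·‖) := (isBigO_refl _ _).norm_right
  induction n with
  | zero => exact ⟨⟨hsid, hOid⟩, ⟨hsX, horiz_isBigO hm⟩⟩
  | succ n ih =>
    obtain ⟨hid, hX⟩ := ih
    refine ⟨.of_frameDeriv hsid hOid (isSymbol_frame_of_horiz hid hX) fun a => ?_,
      .of_frameDeriv hsX (horiz_isBigO hm) (fun a =>
        ((((isSymbol_invR_one hm).mul_left (isSymbol_dR hm a)).smul_left hX).neg.add
          (((isSymbol_dy₁ hm a).const_mul (4 * m)).smul_left (hX.clm_comp axial))).add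
          (isSymbol_conjLift_frame hm hid hX a)) fun a => ?_⟩
    · exact .of_forall fun z => by simp [frameDeriv]
    · filter_upwards [eventually_ne_zero] with z hz using (frameDeriv_horiz hm hz a).symm

theorem isSymbol_frame (hm : 0 < m) (a : Fin 4) : IsSymbol (frame m) (‖·‖) n (frame m a) :=
  isSymbol_frame_of_horiz (isSymbol_id_horiz hm n).1 (isSymbol_id_horiz hm n).2 a

/-! ### Exterior derivatives of the coframe -/

theorem symp_self_axial (z : C2) : symp z (axial z) = -(2 * Complex.I * yC z) := by
  rw [symp_apply, axial_zero, axial_one, yC]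
  linear_combination -(2 * (z 0 * z 1)) * Complex.I_sq

theorem symp_self_horiz (hm : 0 < m) (z : C2) :
    symp z (horiz m z) = Complex.I * dirY m z := by
  rw [symp_apply, horiz, conjLift_zero, conjLift_one, dirY, invR, mul_inv]
  push_cast
  have hfst := exp_neg_mul_conj hm z
  have hsnd := exp_mul_conj hm z
  push_cast at hfst hsnd
  linear_combination Complex.I * (R m z : ℂ)⁻¹ / 2 * (hfst - hsnd)

theorem symp_axial_left (Z W : C2) : symp (axial Z) W = symp (axial W) Z := by
  simp only [symp_apply, axial_zero, axial_one]
  ring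

theorem symp_axial_axial (Z W : C2) : symp (axial Z) (axial W) = -symp Z W := by
  simp only [symp_apply, axial_zero, axial_one]
  ring

theorem symp_axial_horiz_horiz (m : ℝ) (z : C2) :
    symp (axial (horiz m z)) (horiz m z) =
      Complex.I / 2 * (invR m z * starRingEnd ℂ (dirC m z)) := by
  have hexp : (Real.exp (4 * m * y₁ m z) : ℂ) * Real.exp (-(4 * m * y₁ m z)) = 1 := by
    rw [← Complex.ofReal_mul, ← Real.exp_add, add_neg_cancel, Real.exp_zero, Complex.ofReal_one]
  simp only [symp_apply, axial_zero, axial_one, horiz, conjLift_zero, conjLift_one, dirC, yC,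
    invR, mul_inv, Complex.real_smul, map_mul, map_neg, Complex.conj_I, Complex.conj_ofReal]
  push_cast at hexp ⊢
  linear_combination ((R m z : ℂ)⁻¹ ^ 2 / 2 * starRingEnd ℂ (z 0) * starRingEnd ℂ (z 1)) *
    Complex.I ^ 2 * hexp

theorem isSymbol_symp_frame {f : C2 → C2}
    (hN : IsSymbol (frame m) (fun _ => 1) n fun z => symp (f z) (axial z))
    (hX : IsSymbol (frame m) (fun _ => 1) n fun z => symp (f z) (horiz m z)) (b : Fin 4) :
    IsSymbol (frame m) (fun _ => 1) n fun z => symp (f z) (frame m b z) := by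
  fin_cases b
  · exact hN
  · exact (hN.const_mul Complex.I).congr (.of_forall fun z => (symp_I_right _ _).symm)
  · exact hX
  · exact (hX.const_mul Complex.I).congr (.of_forall fun z => (symp_I_right _ _).symm)

theorem isSymbol_symp_axial_horiz_frame (hm : 0 < m) (b : Fin 4) :
    IsSymbol (frame m) (fun _ => 1) n fun z => symp (axial (horiz m z)) (frame m b z) := by
  refine isSymbol_symp_frame ?_ ?_ b
  · simp only [symp_axial_axial, symp_swap (horiz m _), symp_self_horiz hm, neg_neg]
    exact ((isSymbol_dirY hm).clm_comp Complex.ofRealCLM).const_mul Complex.I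
  · simp only [symp_axial_horiz_horiz]
    exact (((isSymbol_invR_one hm).clm_comp Complex.ofRealCLM).mul_left
      ((isSymbol_dirC hm).clm_comp Complex.conjCLE.toContinuousLinearMap)).const_mul _

theorem isSymbol_symp_invR_smul_self_frame (hm : 0 < m) (b : Fin 4) :
    IsSymbol (frame m) (fun _ => 1) n fun z => symp (invR m z • z) (frame m b z) := by
  refine isSymbol_symp_frame ?_ ?_ b
  · refine ((isSymbol_dirC hm).const_mul (-(2 * Complex.I))).congr (.of_forall fun z => ?_)
    simp only [map_smul, smul_apply, symp_self_axial, dirC, Complex.real_smul]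
    ring
  · simp only [map_smul, smul_apply, symp_self_horiz hm]
    exact (isSymbol_invR_one hm).smul_left
      (((isSymbol_dirY hm).clm_comp Complex.ofRealCLM).const_mul Complex.I)

theorem isSymbol_symp_conjLift_frame (hm : 0 < m) (a b : Fin 4) :
    IsSymbol (frame m) (fun _ => 1) n
      fun z => symp (conjLift m z (frame m a z)) (frame m b z) := by
  have hX : IsSymbol (frame m) (fun _ => 1) n fun z => symp (axial (horiz m z)) (frame m b z) :=
    isSymbol_symp_axial_horiz_frame hm b
  have hz : IsSymbol (frame m) (fun _ => 1) n
      fun z => symp ((invR m z ^ 2 / 4) • z) (frame m b z) := by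
    refine (((isSymbol_invR_one hm).smul_left
      (isSymbol_symp_invR_smul_self_frame hm b)).const_mul (1 / 4)).congr (.of_forall fun z => ?_)
    simp only [map_smul, smul_apply, Complex.real_smul]
    push_cast
    ring
  simp only [conjLift_frame]
  fin_cases a
  · exact hX.neg.congr (.of_forall fun z => by simp)
  · exact (hX.const_mul Complex.I).congr (.of_forall fun z => (symp_I_left _ _).symm)
  · exact hz
  · refine (hz.const_mul Complex.I).neg.congr (.of_forall fun z => ?_)
    change -(Complex.I * symp _ _) = symp (-((invR m z ^ 2 / 4) • stdI 0 z)) _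
    rw [← symp_I_left, ← map_smul, map_neg, neg_apply]

theorem fderiv_alpha (hm : 0 < m) {z : C2} (hz : z ≠ 0) (Z W : C2) :
    fderiv ℝ (alpha m) z Z W = Complex.I * symp (fderiv ℝ (horiz m) z Z) W := by
  have hX := ((contDiffAt_horiz hm hz).differentiableAt (by simp)).hasFDerivAt
  have h : HasFDerivAt (alpha m) _ z := (symp.hasFDerivAt.comp z hX).const_smul Complex.I
  rw [h.fderiv]
  rfl

theorem isSymbol_fderiv_alpha (hm : 0 < m) (a b : Fin 4) :
    IsSymbol (frame m) (fun _ => 1) n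
      (fun z => fderiv ℝ (alpha m) z (frame m a z) (frame m b z)) := by
  have hα : IsSymbol (frame m) (fun _ => 1) n (fun z => alpha m z (frame m b z)) := by
    refine (IsSymbol.const (![1, Complex.I, 0, 0] b : ℂ)).congr ?_
    filter_upwards [eventually_ne_zero] with z hz using (alpha_frame hm hz b).symm
  have hX := ((isSymbol_dy₁ hm a).const_mul (4 * m)).smul_left
    (isSymbol_symp_axial_horiz_frame (n := n) hm b)
  refine ((((isSymbol_invR_one hm).mul_left (isSymbol_dR hm a)).smul_left hα).neg.add
    ((hX.add (isSymbol_symp_conjLift_frame hm a b)).const_mul Complex.I)).congr ?_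
  filter_upwards [eventually_ne_zero] with z hz
  rw [fderiv_alpha hm hz, ← frameDeriv, frameDeriv_horiz hm hz, alpha_eq_I_mul_symp]
  simp only [map_add, map_neg, map_smul, add_apply, neg_apply, smul_apply, Complex.real_smul]
  ring

theorem dOneForm_beta (z Z W : C2) : dOneForm beta z Z W = 0 := by
  have h : HasFDerivAt beta _ z := (symp.comp axial).hasFDerivAt.const_smul (-Complex.I)
  rw [dOneForm, h.fderiv]
  change -Complex.I * symp (axial Z) W - -Complex.I * symp (axial W) Z = 0
  rw [symp_axial_left, sub_self]

theorem isSymbol_dOneForm_coframe (hm : 0 < m) (c a b : Fin 4) :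
    IsSymbol (frame m) (fun _ => 1) n
      fun z => dOneForm (coframe m c) z (frame m a z) (frame m b z) := by
  have hα (L : ℂ →L[ℝ] ℝ) : IsSymbol (frame m) (fun _ => 1) n
      fun z => dOneForm (fun w => L ∘L alpha m w) z (frame m a z) (frame m b z) := by
    refine (((isSymbol_fderiv_alpha hm a b).sub (isSymbol_fderiv_alpha hm b a)).clm_comp L).congr ?_
    filter_upwards [eventually_ne_zero] with z hz
    rw [dOneForm_clm_comp L ((contDiffAt_alpha hm hz).differentiableAt (by simp)), dOneForm]
  have hβ (L : ℂ →L[ℝ] ℝ) : IsSymbol (frame m) (fun _ => 1) n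
      fun z => dOneForm (fun w => L ∘L beta w) z (frame m a z) (frame m b z) := by
    refine IsSymbol.zero.congr (.of_forall fun z => ?_)
    beta_reduce
    rw [dOneForm_clm_comp L (contDiff_beta.differentiable (by simp) z), dOneForm_beta, map_zero]
  fin_cases c
  exacts [hα Complex.reCLM, hα Complex.imCLM, hβ Complex.reCLM, hβ Complex.imCLM]

/-! ### Symbols built from hyperbolic functions of `y₁` -/

/-- The quotient `2 R / r²`, written in terms of `y₁ / R`. -/
def normQuot (m : ℝ) (z : C2) : ℝ :=
  (Real.cosh (4 * m * y₁ m z) + dirY m z * Real.sinh (4 * m * y₁ m z))⁻¹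

/-- The quotient `2 R sinh (4 m y₁) / r²`. -/
def sinhQuot (m : ℝ) (z : C2) : ℝ := normQuot m z * Real.sinh (4 * m * y₁ m z)

theorem dirY_mul_sinh_nonneg (hm : 0 < m) (z : C2) :
    0 ≤ dirY m z * Real.sinh (4 * m * y₁ m z) := by
  rw [dirY, mul_assoc]
  exact mul_nonneg (inv_nonneg.2 (R_nonneg z)) (mul_sinh_nonneg hm _)

theorem inv_normQuot_pos (hm : 0 < m) (z : C2) :
    0 < Real.cosh (4 * m * y₁ m z) + dirY m z * Real.sinh (4 * m * y₁ m z) :=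
  add_pos_of_pos_of_nonneg (Real.cosh_pos _) (dirY_mul_sinh_nonneg hm z)

theorem cosh_mul_normQuot (hm : 0 < m) (z : C2) :
    Real.cosh (4 * m * y₁ m z) * normQuot m z = 1 - dirY m z * sinhQuot m z := by
  have h := mul_inv_cancel₀ (inv_normQuot_pos hm z).ne'
  rw [sinhQuot]
  rw [← normQuot] at h
  linear_combination h

theorem inv_norm_sq_eq (hm : 0 < m) {z : C2} (hz : z ≠ 0) :
    (‖z‖ ^ 2)⁻¹ = 1 / 2 * (normQuot m z * invR m z) := by
  have hR := (R_pos hm hz).ne'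
  have hr : ‖z‖ ^ 2 = 2 * R m z *
      (Real.cosh (4 * m * y₁ m z) + dirY m z * Real.sinh (4 * m * y₁ m z)) := by
    rw [norm_sq_eq_cosh_sinh hm, dirY, invR]
    field_simp
  rw [hr, normQuot, invR, mul_inv, mul_inv]
  ring

theorem smoothAtInfinity_normQuot (hm : 0 < m) : SmoothAtInfinity (normQuot m) := by
  filter_upwards [smoothAtInfinity_dirY hm] with z hz
  have hy : ContDiffAt ℝ ∞ (fun z => 4 * m * y₁ m z) z :=
    contDiffAt_const.mul (contDiff_y₁ hm).contDiffAt
  exact (hy.cosh.add (hz.mul hy.sinh)).inv (inv_normQuot_pos hm z).ne'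

theorem smoothAtInfinity_sinhQuot (hm : 0 < m) : SmoothAtInfinity (sinhQuot m) :=
  (smoothAtInfinity_normQuot hm).mono fun _ hz =>
    hz.mul (contDiffAt_const.mul (contDiff_y₁ hm).contDiffAt).sinh

theorem abs_sinhQuot_le_one (hm : 0 < m) (z : C2) : |sinhQuot m z| ≤ 1 := by
  rw [sinhQuot, normQuot, abs_mul, abs_inv, abs_of_pos (inv_normQuot_pos hm z),
    inv_mul_le_iff₀ (inv_normQuot_pos hm z), mul_one, abs_le]
  have hs := Real.sinh_lt_cosh (4 * m * y₁ m z)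
  have hs' := Real.sinh_lt_cosh (-(4 * m * y₁ m z))
  rw [Real.sinh_neg, Real.cosh_neg] at hs'
  constructor <;> linarith [dirY_mul_sinh_nonneg hm z]

theorem abs_normQuot_le_one (hm : 0 < m) (z : C2) : |normQuot m z| ≤ 1 := by
  rw [normQuot, abs_inv, abs_of_pos (inv_normQuot_pos hm z)]
  exact inv_le_one_of_one_le₀ (by
    linarith [Real.one_le_cosh (4 * m * y₁ m z), dirY_mul_sinh_nonneg hm z])

theorem hasFDerivAt_normQuot (hm : 0 < m) {z : C2} (hz : z ≠ 0) :
    HasFDerivAt (normQuot m) (-(normQuot m z) •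
      ((4 * m * (sinhQuot m z + dirY m z * (1 - dirY m z * sinhQuot m z))) • fderiv ℝ (y₁ m) z
        + sinhQuot m z • fderiv ℝ (dirY m) z)) z := by
  have hy := (((contDiff_y₁ hm).differentiable (by simp) z).hasFDerivAt).const_mul (4 * m)
  have hY := (differentiableAt_dirY hm hz).hasFDerivAt
  have h := ((hasDerivAt_inv (inv_normQuot_pos hm z).ne').comp_hasFDerivAt z
    (hy.cosh.add (hY.mul hy.sinh)))
  refine HasFDerivAt.congr_fderiv (f := normQuot m) h ?_
  rw [← cosh_mul_normQuot hm, sinhQuot, ← inv_pow, ← normQuot]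
  module

theorem hasFDerivAt_sinhQuot (hm : 0 < m) {z : C2} (hz : z ≠ 0) :
    HasFDerivAt (sinhQuot m) ((4 * m * normQuot m z ^ 2) • fderiv ℝ (y₁ m) z
      - sinhQuot m z ^ 2 • fderiv ℝ (dirY m) z) z := by
  have hy := (((contDiff_y₁ hm).differentiable (by simp) z).hasFDerivAt).const_mul (4 * m)
  refine HasFDerivAt.congr_fderiv (f := sinhQuot m)
    ((hasFDerivAt_normQuot hm hz).mul hy.sinh) ?_
  have hcosh := cosh_mul_normQuot hm z
  have hsq := Real.cosh_sq (4 * m * y₁ m z)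
  have hsinh : sinhQuot m z = normQuot m z * Real.sinh (4 * m * y₁ m z) := rfl
  have h : normQuot m z * Real.cosh (4 * m * y₁ m z) - sinhQuot m z *
      (sinhQuot m z + dirY m z * (1 - dirY m z * sinhQuot m z)) = normQuot m z ^ 2 := by
    linear_combination (sinhQuot m z * dirY m z
        - normQuot m z * Real.cosh (4 * m * y₁ m z)) * hcosh
      + normQuot m z ^ 2 * hsq - (sinhQuot m z + normQuot m z * Real.sinh (4 * m * y₁ m z)) * hsinh
  ext Z
  simp only [add_apply, sub_apply, smul_apply, smul_eq_mul, ← h]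
  rw [hsinh]
  ring

theorem frameDeriv_normQuot (hm : 0 < m) {z : C2} (hz : z ≠ 0) (a : Fin 4) :
    frameDeriv (frame m) a (normQuot m) z =
      -(normQuot m z * (4 * m * ((sinhQuot m z + dirY m z * (1 - dirY m z * sinhQuot m z))
          * dy₁ m a z)
        + sinhQuot m z * frameDeriv (frame m) a (dirY m) z)) := by
  rw [← frameDeriv_y₁ hm hz, frameDeriv_eq (hasFDerivAt_normQuot hm hz), frameDeriv, frameDeriv]
  simp only [smul_apply, add_apply, smul_eq_mul]
  ring

theorem frameDeriv_sinhQuot (hm : 0 < m) {z : C2} (hz : z ≠ 0) (a : Fin 4) :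
    frameDeriv (frame m) a (sinhQuot m) z =
      4 * m * (normQuot m z * (normQuot m z * dy₁ m a z))
        - sinhQuot m z * (sinhQuot m z * frameDeriv (frame m) a (dirY m) z) := by
  rw [← frameDeriv_y₁ hm hz, frameDeriv_eq (hasFDerivAt_sinhQuot hm hz), frameDeriv, frameDeriv]
  simp only [smul_apply, sub_apply, smul_eq_mul]
  ring

theorem isSymbol_sinhQuot_normQuot (hm : 0 < m) (n : ℕ) :
    IsSymbol (frame m) (fun _ => 1) n (sinhQuot m) ∧
      IsSymbol (frame m) (fun _ => 1) n (normQuot m) := by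
  have hss := smoothAtInfinity_sinhQuot hm
  have hsN := smoothAtInfinity_normQuot hm
  have hOs : sinhQuot m =O[cobounded C2] (fun _ => (1 : ℝ)) :=
    .of_bound 1 (.of_forall fun z => by simpa using abs_sinhQuot_le_one hm z)
  have hON : normQuot m =O[cobounded C2] (fun _ => (1 : ℝ)) :=
    .of_bound 1 (.of_forall fun z => by simpa using abs_normQuot_le_one hm z)
  induction n with
  | zero => exact ⟨⟨hss, hOs⟩, ⟨hsN, hON⟩⟩
  | succ n ih =>
    obtain ⟨hs, hN⟩ := ih
    have hY : IsSymbol (frame m) (fun _ => 1) n (dirY m) := isSymbol_dirY hm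
    have hdy := isSymbol_dy₁ (n := n) hm
    have hdY (a : Fin 4) : IsSymbol (frame m) (fun _ => 1) n (frameDeriv (frame m) a (dirY m)) :=
      (isSymbol_dirY hm).frameDeriv a
    have hcosh := (IsSymbol.const (1 : ℝ)).sub (hY.mul_left hs)
    refine ⟨.of_frameDeriv hss hOs (fun a =>
        ((hN.mul_left (hN.mul_left (hdy a))).const_mul (4 * m)).sub
          (hs.mul_left (hs.mul_left (hdY a)))) fun a => ?_,
      .of_frameDeriv hsN hON (fun a => (hN.mul_left
        ((((hs.add (hY.mul_left hcosh)).mul_left (hdy a)).const_mul (4 * m)).add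
          (hs.mul_left (hdY a)))).neg) fun a => ?_⟩
    all_goals filter_upwards [eventually_ne_zero] with z hz
    exacts [(frameDeriv_sinhQuot hm hz a).symm, (frameDeriv_normQuot hm hz a).symm]

theorem isSymbol_sinhQuot (hm : 0 < m) :
    IsSymbol (frame m) (fun _ => 1) n (sinhQuot m) :=
  (isSymbol_sinhQuot_normQuot hm n).1

theorem isSymbol_normQuot (hm : 0 < m) :
    IsSymbol (frame m) (fun _ => 1) n (normQuot m) :=
  (isSymbol_sinhQuot_normQuot hm n).2

theorem isSymbolicFrame_metric (hm : 0 < m) :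
    IsSymbolicFrame (metric m) (frame m) (coframe m) (metricDiag m) where
  eventually_isDiagonalFrameAt := by
    filter_upwards [eventually_ne_zero] with z hz
    exact {
      coframe_frame := coframe_frame hm hz
      eventually_metric_eq := (eventually_ne_nhds hz).mono fun w hw => metric_eq_sum hm hw
      diag_pos := metricDiag_pos hm hz
      differentiableAt_diag := fun a => (contDiffAt_metricDiag hm hz a).differentiableAt (by simp)
      differentiableAt_coframe := fun a => (contDiffAt_coframe hm hz a).differentiableAt (by simp) }
  isSymbol_diag a n := by
    fin_cases a
    exacts [isSymbol_invV hm, isSymbol_invV hm, isSymbol_V hm, isSymbol_V hm]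
  isSymbol_inv_diag a n := by
    have hV : IsSymbol (frame m) (fun _ => 1) n fun z => (V m z)⁻¹⁻¹ := by
      simpa only [inv_inv] using isSymbol_V hm
    fin_cases a
    exacts [hV, hV, isSymbol_invV hm, isSymbol_invV hm]
  isSymbol_dOneForm c a b n := isSymbol_dOneForm_coframe hm c a b

/-! ### The function `ψ_c` -/

theorem psiC_eq (hm : 0 < m) {z : C2} (hz : z ≠ 0) :
    psiC m z = (-(1 / 8) * sinhQuot m z) • (invR m z • dirC m z) := by
  have hrR : ((‖z‖ ^ 2 * R m z : ℝ) : ℂ)⁻¹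
      = ((1 / 2 * (normQuot m z * invR m z) * invR m z : ℝ) : ℂ) := by
    rw [← inv_norm_sq_eq hm hz, invR, ← mul_inv]
    push_cast
    rfl
  rw [psiC, div_eq_mul_inv, hrR, dirC, sinhQuot]
  simp only [Complex.real_smul]
  push_cast
  ring

theorem isSymbol_invR_smul_dirC (hm : 0 < m) :
    IsSymbol (frame m) (invR m) n (fun z => invR m z • dirC m z) := by
  simpa using (isSymbol_invR hm).smul (isSymbol_dirC hm)

theorem isSymbol_psiC (hm : 0 < m) : IsSymbol (frame m) (invR m) n (psiC m) := by
  refine (((isSymbol_sinhQuot hm).const_mul (-(1 / 8))).smul_left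
    (isSymbol_invR_smul_dirC hm)).congr ?_
  filter_upwards [eventually_ne_zero] with z hz using (psiC_eq hm hz).symm

theorem isSymbol_frameDeriv_dirY (hm : 0 < m) (a : Fin 4) :
    IsSymbol (frame m) (invR m) n (frameDeriv (frame m) a (dirY m)) := by
  have h := (isSymbol_invR (n := n) hm).mul
    ((isSymbol_dy₁ hm a).sub ((isSymbol_dR hm a).mul_left (isSymbol_dirY hm)))
  simp only [mul_one] at h
  refine h.congr ?_
  filter_upwards [eventually_ne_zero] with z hz using (frameDeriv_dirY hm hz a).symm

theorem differentiableAt_dirC (hm : 0 < m) {z : C2} (hz : z ≠ 0) :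
    DifferentiableAt ℝ (dirC m) z :=
  (hasFDerivAt_invR hm hz).differentiableAt.smul (hasFDerivAt_yC z).differentiableAt

theorem frameDeriv_invR_smul_dirC (hm : 0 < m) {z : C2} (hz : z ≠ 0) (a : Fin 4) :
    frameDeriv (frame m) a (fun z => invR m z • dirC m z) z =
      (invR m z * invR m z) • (dyC a - (2 * dR m a z) • dirC m z) := by
  rw [frameDeriv_smul (hasFDerivAt_invR hm hz).differentiableAt (differentiableAt_dirC hm hz),
    frameDeriv_invR hm hz, frameDeriv_dirC hm hz]
  module

theorem isSymbol_frameDeriv_invR_smul_dirC (hm : 0 < m) (a : Fin 4) :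
    IsSymbol (frame m) (fun z => invR m z * invR m z) n
      (frameDeriv (frame m) a (fun z => invR m z • dirC m z)) := by
  have h := ((isSymbol_invR (n := n) hm).mul (isSymbol_invR hm)).smul ((IsSymbol.const (dyC a)).sub
    (((isSymbol_dR hm a).const_mul 2).smul_left (isSymbol_dirC hm)))
  simp only [mul_one] at h
  refine h.congr ?_
  filter_upwards [eventually_ne_zero] with z hz using (frameDeriv_invR_smul_dirC hm hz a).symm

/-- The part of the derivative of `ψ_c` along the frame which is `O(R⁻²)`. -/
def psiRemainder (m : ℝ) (a : Fin 4) (z : C2) : ℂ :=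
  (1 / 8 * (sinhQuot m z * sinhQuot m z)) •
      (frameDeriv (frame m) a (dirY m) z • (invR m z • dirC m z))
    - (1 / 8 * sinhQuot m z) • frameDeriv (frame m) a (fun z => invR m z • dirC m z) z

theorem isSymbol_psiRemainder (hm : 0 < m) (a : Fin 4) :
    IsSymbol (frame m) (fun z => invR m z * invR m z) n (psiRemainder m a) := by
  have hs := isSymbol_sinhQuot (n := n) hm
  exact (((hs.mul_left hs).const_mul (1 / 8)).smul_left
      ((isSymbol_frameDeriv_dirY hm a).smul (isSymbol_invR_smul_dirC hm))).sub
    ((hs.const_mul (1 / 8)).smul_left (isSymbol_frameDeriv_invR_smul_dirC hm a))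

theorem frameDeriv_psiC (hm : 0 < m) {z : C2} (hz : z ≠ 0) (a : Fin 4) :
    frameDeriv (frame m) a (psiC m) z = psiRemainder m a z
      - (1 / 2 * (m * (normQuot m z ^ 2 * dy₁ m a z))) • (invR m z • dirC m z) := by
  have hs := (hasFDerivAt_sinhQuot hm hz).differentiableAt
  have hρ : DifferentiableAt ℝ (fun z => invR m z • dirC m z) z :=
    (hasFDerivAt_invR hm hz).differentiableAt.smul (differentiableAt_dirC hm hz)
  have hψ : psiC m =ᶠ[𝓝 z] fun z => (-(1 / 8) : ℝ) • sinhQuot m z • (invR m z • dirC m z) := by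
    filter_upwards [eventually_ne_nhds hz] with w hw
    rw [psiC_eq hm hw]
    module
  rw [frameDeriv, hψ.fderiv_eq, ← frameDeriv, frameDeriv_const_smul (hs.fun_smul hρ),
    frameDeriv_smul hs hρ, frameDeriv_sinhQuot hm hz, psiRemainder]
  module

theorem inv_norm_sq_sq_smul_yC (hm : 0 < m) {z : C2} (hz : z ≠ 0) :
    ((‖z‖ ^ 2)⁻¹ ^ 2) • yC z = (1 / 4 * normQuot m z ^ 2) • (invR m z • dirC m z) := by
  rw [inv_norm_sq_eq hm hz, dirC]
  module

/- As `4 m V⁻¹ = 2 + O(R⁻¹)`, the leading term of `dψ_c(N)` is `-y_ℂ / r⁴`. -/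
theorem isSymbol_frameDeriv_psiC_zero_add (hm : 0 < m) :
    IsSymbol (frame m) (fun z => invR m z * invR m z) n
      (fun z => frameDeriv (frame m) 0 (psiC m) z + ((‖z‖ ^ 2)⁻¹ ^ 2) • yC z) := by
  have hN := isSymbol_normQuot (n := n) hm
  have herr := (((hN.mul_left hN).mul_left (isSymbol_invV hm)).const_mul (1 / 8)).smul_left
    ((isSymbol_invR hm).smul (isSymbol_invR_smul_dirC hm))
  refine ((isSymbol_psiRemainder hm 0).add herr).congr ?_
  filter_upwards [eventually_ne_zero] with z hz
  have hV : 4 * m * (V m z)⁻¹ = 2 - invR m z * (V m z)⁻¹ := by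
    have hVz := (V_pos hm hz).ne'
    have hVeq := V_eq hm hz
    rw [← invR] at hVeq
    field_simp
    linarith
  rw [frameDeriv_psiC hm hz, inv_norm_sq_sq_smul_yC hm hz, sub_add, ← sub_smul, sub_eq_add_neg,
    ← neg_smul, smul_smul]
  congr 2
  simp only [dy₁, Matrix.cons_val_zero]
  linear_combination (1 / 8 * normQuot m z ^ 2) * hV

theorem isSymbol_frameDeriv_psiC (hm : 0 < m) {a : Fin 4} (ha : a ≠ 0) :
    IsSymbol (frame m) (fun z => invR m z * invR m z) n (frameDeriv (frame m) a (psiC m)) := by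
  have hdy (z : C2) : dy₁ m a z = 0 := by
    obtain ⟨b, rfl⟩ := Fin.exists_succ_eq.2 ha
    fin_cases b <;> rfl
  refine (isSymbol_psiRemainder hm a).congr ?_
  filter_upwards [eventually_ne_zero] with z hz
  rw [frameDeriv_psiC hm hz, hdy]
  simp

theorem isSymbol_inv_norm_sq_sq_mul_dirY (hm : 0 < m) :
    IsSymbol (frame m) (fun z => invR m z * invR m z) n
      (fun z => (((‖z‖ ^ 2)⁻¹ ^ 2 * dirY m z : ℝ) : ℂ)) := by
  have hN := isSymbol_normQuot (n := n) hm
  have h := (((hN.mul_left hN).mul_left (isSymbol_dirY hm)).const_mul (1 / 4)).mul_left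
    ((isSymbol_invR hm).mul (isSymbol_invR hm))
  refine (h.clm_comp Complex.ofRealCLM).congr ?_
  filter_upwards [eventually_ne_zero] with z hz
  rw [inv_norm_sq_eq hm hz, Complex.ofRealCLM_apply]
  congr 1
  ring

/-! ### The complex Hessian of `ψ_c` -/

/-- The 1-form `J dψ`, whose exterior derivative is `dd^c_J ψ`. -/
def dcForm (J : C2 → C2 →L[ℝ] C2) (ψ : C2 → ℂ) (z : C2) : C2 →L[ℝ] ℂ := -(fderiv ℝ ψ z ∘L J z)

/-- The 1-form `-½ r⁻⁴ (z₁ dz₂ - z₂ dz₁)`, a primitive of `θ₂ + i θ₃`. -/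
def thetaPrimitive (z : C2) : C2 →L[ℝ] ℂ := (-(1 / 2) * (‖z‖ ^ 2)⁻¹ ^ 2) • symp z

/-- A primitive of `dd^c_J ψ - (θ₂ + i θ₃)`. The closed form `i dψ` is subtracted to make it of
type `(1,0)` for `J = I₁`. -/
def hessianPrimitive (J : C2 → C2 →L[ℝ] C2) (ψ : C2 → ℂ) (z : C2) : C2 →L[ℝ] ℂ :=
  dcForm J ψ z - Complex.I • fderiv ℝ ψ z - thetaPrimitive z

theorem dcForm_apply (J : C2 → C2 →L[ℝ] C2) (ψ : C2 → ℂ) (z Z : C2) :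
    dcForm J ψ z Z = -fderiv ℝ ψ z (J z Z) := rfl

theorem thetaPrimitive_apply (z Z : C2) :
    thetaPrimitive z Z = -(1 / 2) * ((‖z‖ ^ 2)⁻¹ ^ 2 : ℝ) * symp z Z := by
  simp [thetaPrimitive]

theorem hessianPrimitive_apply (J : C2 → C2 →L[ℝ] C2) (ψ : C2 → ℂ) (z Z : C2) :
    hessianPrimitive J ψ z Z = -fderiv ℝ ψ z (J z Z) - Complex.I * fderiv ℝ ψ z Z
      + 1 / 2 * ((‖z‖ ^ 2)⁻¹ ^ 2 : ℝ) * symp z Z := by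
  rw [hessianPrimitive, sub_apply, sub_apply, dcForm_apply, thetaPrimitive_apply, smul_apply,
    smul_eq_mul]
  ring

theorem differentiableAt_dcForm {J : C2 → C2 →L[ℝ] C2} {ψ : C2 → ℂ} {z : C2}
    (hψ : DifferentiableAt ℝ (fderiv ℝ ψ) z) (hJ : DifferentiableAt ℝ J z) :
    DifferentiableAt ℝ (dcForm J ψ) z :=
  (hψ.clm_comp hJ).fun_neg

theorem ddc_eq_dOneForm {J : C2 → C2 →L[ℝ] C2} {ψ : C2 → ℂ} {z : C2}
    (hψ : DifferentiableAt ℝ (fderiv ℝ ψ) z) (hJ : DifferentiableAt ℝ J z) (Z : Fin 2 → C2) :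
    ddc J ψ z Z = dOneForm (dcForm J ψ) z (Z 0) (Z 1) := by
  have h (U W : C2) : fderiv ℝ (fun w => -fderiv ℝ ψ w (J w W)) z U
      = fderiv ℝ (dcForm J ψ) z U W := by
    have hW : HasFDerivAt (fun w => -fderiv ℝ ψ w (J w W))
        ((fderiv ℝ (dcForm J ψ) z).flip W) z := by
      simpa using! (differentiableAt_dcForm hψ hJ).hasFDerivAt.clm_apply (hasFDerivAt_const W z)
    rw [hW.fderiv, ContinuousLinearMap.flip_apply]
  rw [ddc, h, h, dOneForm]

theorem contDiffAt_inv_norm_sq {z : C2} (hz : z ≠ 0) :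
    ContDiffAt ℝ ∞ (fun w : C2 => (‖w‖ ^ 2)⁻¹) z :=
  (contDiff_norm_sq ℝ).contDiffAt.inv (by simpa using hz)

theorem contDiffAt_thetaPrimitive {z : C2} (hz : z ≠ 0) : ContDiffAt ℝ ∞ thetaPrimitive z :=
  (contDiffAt_const.mul ((contDiffAt_inv_norm_sq hz).pow 2)).smul symp.contDiff.contDiffAt

theorem fderiv_inv_norm_sq {z : C2} (hz : z ≠ 0) (Z : C2) :
    fderiv ℝ (fun w : C2 => (((‖w‖ ^ 2)⁻¹ : ℝ) : ℂ)) z Z =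
      ((-2 * (‖z‖ ^ 2)⁻¹ ^ 2 * ((starRingEnd ℂ (z 0) * Z 0).re
        + (starRingEnd ℂ (z 1) * Z 1).re) : ℝ) : ℂ) := by
  have hsq : HasFDerivAt (fun w : C2 => ‖w‖ ^ 2) (2 • innerSL ℝ z) z :=
    (hasStrictFDerivAt_norm_sq z).hasFDerivAt
  have h0 : ‖z‖ ^ 2 ≠ 0 := by simpa using hz
  have h : HasFDerivAt (fun w : C2 => (((‖w‖ ^ 2)⁻¹ : ℝ) : ℂ)) _ z :=
    Complex.ofRealCLM.hasFDerivAt.comp z ((hasDerivAt_inv h0).comp_hasFDerivAt z hsq)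
  have hinner : inner ℝ z Z
      = (starRingEnd ℂ (z 0) * Z 0).re + (starRingEnd ℂ (z 1) * Z 1).re := by
    simp [PiLp.inner_apply, Complex.inner, mul_comm]
  rw [h.fderiv]
  simp only [ContinuousLinearMap.comp_apply, smul_apply, innerSL_apply_apply, hinner,
    Complex.ofRealCLM_apply, smul_eq_mul, nsmul_eq_mul, Nat.cast_ofNat, inv_pow]
  congr 1
  ring

theorem thetaPrimitive_eq {z : C2} (hz : z ≠ 0) :
    thetaPrimitive z =
      (1 / 4 : ℂ) • dcForm (fun _ => stdI 1) (fun w => (((‖w‖ ^ 2)⁻¹ : ℝ) : ℂ)) z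
      + (Complex.I / 4) • dcForm (fun _ => stdI 2) (fun w => (((‖w‖ ^ 2)⁻¹ : ℝ) : ℂ)) z := by
  ext Z
  have hI₂0 : (stdI 1 Z) 0 = -starRingEnd ℂ (Z 1) := rfl
  have hI₂1 : (stdI 1 Z) 1 = starRingEnd ℂ (Z 0) := rfl
  have hI₃0 : (stdI 2 Z) 0 = Complex.I * -starRingEnd ℂ (Z 1) := rfl
  have hI₃1 : (stdI 2 Z) 1 = Complex.I * starRingEnd ℂ (Z 0) := rfl
  rw [add_apply, smul_apply, smul_apply, dcForm_apply, dcForm_apply, fderiv_inv_norm_sq hz,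
    fderiv_inv_norm_sq hz, hI₂0, hI₂1, hI₃0, hI₃1, thetaPrimitive_apply, symp_apply]
  generalize (‖z‖ ^ 2)⁻¹ ^ 2 = t
  apply Complex.ext <;> simp <;> ring

theorem thetaC_eq {z : C2} (hz : z ≠ 0) (Z : Fin 2 → C2) :
    thetaC z Z = dOneForm thetaPrimitive z (Z 0) (Z 1) := by
  have hψ : DifferentiableAt ℝ (fderiv ℝ fun w : C2 => (((‖w‖ ^ 2)⁻¹ : ℝ) : ℂ)) z :=
    ((Complex.ofRealCLM.contDiff.contDiffAt.comp z (contDiffAt_inv_norm_sq hz)).fderiv_right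
      (m := ∞) (by simp)).differentiableAt (by simp)
  have hJ (j : Fin 3) : DifferentiableAt ℝ (fun _ : C2 => stdI j) z := differentiableAt_const _
  have hd (j : Fin 3) := differentiableAt_dcForm hψ (hJ j)
  have hnear := (eventually_ne_nhds hz).mono fun w hw => thetaPrimitive_eq hw
  rw [dOneForm_congr hnear, dOneForm_add ((hd 1).fun_const_smul _) ((hd 2).fun_const_smul _),
    dOneForm_const_smul (hd 1), dOneForm_const_smul (hd 2), thetaC, theta, theta,
    ddc_eq_dOneForm hψ (hJ 1), ddc_eq_dOneForm hψ (hJ 2), smul_eq_mul, smul_eq_mul]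
  ring

theorem ddc_sub_thetaC_eq {J : C2 → C2 →L[ℝ] C2} {ψ : C2 → ℂ} {z : C2} (hz : z ≠ 0)
    (hψ : ContDiffAt ℝ ∞ ψ z) (hJ : DifferentiableAt ℝ J z) (Z : Fin 2 → C2) :
    (ddc J ψ - thetaC) z Z = dOneForm (hessianPrimitive J ψ) z (Z 0) (Z 1) := by
  have hdψ : DifferentiableAt ℝ (fderiv ℝ ψ) z :=
    (hψ.fderiv_right (m := ∞) (by simp)).differentiableAt (by simp)
  have hdc := differentiableAt_dcForm hdψ hJ
  have hθ := (contDiffAt_thetaPrimitive hz).differentiableAt (by simp)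
  have hclosed : dOneForm (fun w => Complex.I • fderiv ℝ ψ w) z (Z 0) (Z 1) = 0 := by
    rw [dOneForm_const_smul hdψ, dOneForm_fderiv hψ, smul_zero]
  calc (ddc J ψ - thetaC) z Z
      = dOneForm (dcForm J ψ) z (Z 0) (Z 1) - dOneForm thetaPrimitive z (Z 0) (Z 1) := by
        rw [Pi.sub_apply, Pi.sub_apply, ddc_eq_dOneForm hdψ hJ, thetaC_eq hz]
    _ = dOneForm (hessianPrimitive J ψ) z (Z 0) (Z 1) := by
        unfold hessianPrimitive
        rw [dOneForm_sub (hdc.fun_sub (hdψ.fun_const_smul Complex.I)) hθ,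
          dOneForm_sub hdc (hdψ.fun_const_smul Complex.I), hclosed, sub_zero]

theorem hessianPrimitive_stdI (ψ : C2 → ℂ) (z Z : C2) :
    hessianPrimitive (fun _ => stdI 0) ψ z (stdI 0 Z)
      = Complex.I * hessianPrimitive (fun _ => stdI 0) ψ z Z := by
  have hI : stdI 0 (stdI 0 Z) = -Z := by
    rw [stdI_zero_apply, stdI_zero_apply, smul_smul, Complex.I_mul_I, neg_one_smul]
  rw [hessianPrimitive_apply, hessianPrimitive_apply, hI, map_neg, symp_I_right]
  linear_combination fderiv ℝ ψ z Z * Complex.I_sq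

theorem hessianPrimitive_psiC_axial (m : ℝ) (z : C2) :
    hessianPrimitive (fun _ => stdI 0) (psiC m) z (axial z) =
      -frameDeriv (frame m) 1 (psiC m) z
        - Complex.I * (frameDeriv (frame m) 0 (psiC m) z + (‖z‖ ^ 2)⁻¹ ^ 2 • yC z) := by
  rw [hessianPrimitive_apply, symp_self_axial, Complex.real_smul]
  simp only [frameDeriv, frame, Matrix.cons_val]
  ring

theorem hessianPrimitive_psiC_horiz (hm : 0 < m) (z : C2) :
    hessianPrimitive (fun _ => stdI 0) (psiC m) z (horiz m z) =
      -frameDeriv (frame m) 3 (psiC m) z - Complex.I * frameDeriv (frame m) 2 (psiC m) z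
        + Complex.I / 2 * (((‖z‖ ^ 2)⁻¹ ^ 2 * dirY m z : ℝ) : ℂ) := by
  rw [hessianPrimitive_apply, symp_self_horiz hm]
  simp only [frameDeriv, frame, Matrix.cons_val]
  push_cast
  ring

theorem isSymbol_hessianPrimitive_psiC (hm : 0 < m) (a : Fin 4) :
    IsSymbol (frame m) (fun z => invR m z * invR m z) n
      fun z => hessianPrimitive (fun _ => stdI 0) (psiC m) z (frame m a z) := by
  have haxial : IsSymbol (frame m) (fun z => invR m z * invR m z) n
      fun z => hessianPrimitive (fun _ => stdI 0) (psiC m) z (axial z) := by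
    simp only [hessianPrimitive_psiC_axial]
    exact (isSymbol_frameDeriv_psiC hm (by decide)).neg.sub
      ((isSymbol_frameDeriv_psiC_zero_add hm).const_mul Complex.I)
  have hhoriz : IsSymbol (frame m) (fun z => invR m z * invR m z) n
      fun z => hessianPrimitive (fun _ => stdI 0) (psiC m) z (horiz m z) := by
    simp only [hessianPrimitive_psiC_horiz hm]
    exact ((isSymbol_frameDeriv_psiC hm (by decide)).neg.sub
      ((isSymbol_frameDeriv_psiC hm (by decide)).const_mul Complex.I)).add
      ((isSymbol_inv_norm_sq_sq_mul_dirY hm).const_mul _)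
  fin_cases a
  · exact haxial
  · exact (haxial.const_mul Complex.I).congr
      (.of_forall fun z => (hessianPrimitive_stdI _ _ _).symm)
  · exact hhoriz
  · exact (hhoriz.const_mul Complex.I).congr
      (.of_forall fun z => (hessianPrimitive_stdI _ _ _).symm)

/-! ### Smoothness of the transported complex structure -/

section PullEnd

variable {Y : Type*} [TopologicalSpace Y] [ChartedSpace C2 Y] [IsManifold 𝓘(ℝ, C2) ∞ Y]
  {q : C2 → Y} {z₀ z : C2}

/-- The derivative of `q` at `z`, read in the trivialization of the tangent bundle at `q z₀`. -/
def derivInCoordinates (q : C2 → Y) (z₀ z : C2) : C2 →L[ℝ] C2 :=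
  inTangentCoordinates 𝓘(ℝ, C2) 𝓘(ℝ, C2) id q (mfderiv 𝓘(ℝ, C2) 𝓘(ℝ, C2) q) z₀ z

/-- The endomorphism `J (q z)`, read in the trivialization of the tangent bundle at `q z₀`. -/
def endInCoordinates (q : C2 → Y)
    (J : (p : Y) → TangentSpace 𝓘(ℝ, C2) p →L[ℝ] TangentSpace 𝓘(ℝ, C2) p) (z₀ z : C2) :
    C2 →L[ℝ] C2 :=
  ContinuousLinearMap.inCoordinates C2 (TangentSpace 𝓘(ℝ, C2) (M := Y)) C2
    (TangentSpace 𝓘(ℝ, C2) (M := Y)) (q z₀) (q z) (q z₀) (q z) (J (q z))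

theorem derivInCoordinates_eq
    (hz : q z ∈ (trivializationAt C2 (TangentSpace 𝓘(ℝ, C2) (M := Y)) (q z₀)).baseSet) :
    derivInCoordinates q z₀ z =
      ((trivializationAt C2 (TangentSpace 𝓘(ℝ, C2) (M := Y)) (q z₀)).continuousLinearEquivAt ℝ
        (q z) hz : TangentSpace 𝓘(ℝ, C2) (q z) →L[ℝ] C2) ∘L mfderiv 𝓘(ℝ, C2) 𝓘(ℝ, C2) q z := by
  have hz' : z ∈ (trivializationAt C2 (TangentSpace 𝓘(ℝ, C2) (M := C2)) z₀).baseSet := by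
    simp [chartAt_self_eq]
  refine (ContinuousLinearMap.inCoordinates_eq (E := TangentSpace 𝓘(ℝ, C2) (M := C2))
    (E' := TangentSpace 𝓘(ℝ, C2) (M := Y)) (ϕ := mfderiv 𝓘(ℝ, C2) 𝓘(ℝ, C2) q z) hz' hz).trans ?_
  have hid (v : C2) : ((trivializationAt C2 (TangentSpace 𝓘(ℝ, C2) (M := C2))
      z₀).continuousLinearEquivAt ℝ z hz').symm v = v :=
    (congrFun (Bundle.Trivialization.symm_continuousLinearEquivAt_eq _ hz') v).trans
      (DFunLike.congr_fun (TangentBundle.symmL_model_space (𝕜 := ℝ) z₀ z) v)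
  ext1 v
  exact congrArg (fun u => (trivializationAt C2 (TangentSpace 𝓘(ℝ, C2) (M := Y))
    (q z₀)).continuousLinearEquivAt ℝ (q z) hz (mfderiv 𝓘(ℝ, C2) 𝓘(ℝ, C2) q z u)) (hid v)

theorem pullEnd_eq_inCoordinates
    (J : (p : Y) → TangentSpace 𝓘(ℝ, C2) p →L[ℝ] TangentSpace 𝓘(ℝ, C2) p)
    (hq : IsLocalDiffeomorphAt 𝓘(ℝ, C2) 𝓘(ℝ, C2) ∞ q z)
    (hz : q z ∈ (trivializationAt C2 (TangentSpace 𝓘(ℝ, C2) (M := Y)) (q z₀)).baseSet) :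
    pullEnd q J z = (derivInCoordinates q z₀ z).inverse ∘L endInCoordinates q J z₀ z
      ∘L derivInCoordinates q z₀ z := by
  let C := (trivializationAt C2 (TangentSpace 𝓘(ℝ, C2) (M := Y))
    (q z₀)).continuousLinearEquivAt ℝ (q z) hz
  let L := hq.mfderivToContinuousLinearEquiv (by simp)
  have hJ : endInCoordinates q J z₀ z = (C : TangentSpace 𝓘(ℝ, C2) (q z) →L[ℝ] C2) ∘L J (q z) ∘L
      (C.symm : C2 →L[ℝ] TangentSpace 𝓘(ℝ, C2) (q z)) :=
    ContinuousLinearMap.inCoordinates_eq hz hz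
  have hD : derivInCoordinates q z₀ z
      = ((L.trans C : TangentSpace 𝓘(ℝ, C2) z ≃L[ℝ] C2) : TangentSpace 𝓘(ℝ, C2) z →L[ℝ] C2) :=
    derivInCoordinates_eq hz
  have hDinv : (derivInCoordinates q z₀ z).inverse
      = ((L.trans C).symm : C2 →L[ℝ] TangentSpace 𝓘(ℝ, C2) z) := by
    rw [hD]
    exact ContinuousLinearMap.inverse_equiv _
  have hpull : pullEnd q J z = (L.symm : TangentSpace 𝓘(ℝ, C2) (q z) →L[ℝ]
      TangentSpace 𝓘(ℝ, C2) z) ∘L J (q z) ∘L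
      (L : TangentSpace 𝓘(ℝ, C2) z →L[ℝ] TangentSpace 𝓘(ℝ, C2) (q z)) := by
    rw [← ContinuousLinearMap.inverse_equiv L]
    rfl
  rw [hpull, hJ, hDinv, hD]
  ext1 v
  change L.symm (J (q z) (L v)) = L.symm (C.symm (C (J (q z) (C.symm (C (L v))))))
  rw [C.symm_apply_apply, C.symm_apply_apply]

theorem contDiffAt_pullEnd
    {J : (p : Y) → TangentSpace 𝓘(ℝ, C2) p →L[ℝ] TangentSpace 𝓘(ℝ, C2) p}
    (hJ : ContMDiff 𝓘(ℝ, C2) (𝓘(ℝ, C2).prod 𝓘(ℝ, C2 →L[ℝ] C2)) ∞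
      (fun p : Y => Bundle.TotalSpace.mk' (C2 →L[ℝ] C2)
        (E := fun p : Y => TangentSpace 𝓘(ℝ, C2) p →L[ℝ] TangentSpace 𝓘(ℝ, C2) p) p (J p)))
    (hq : ∀ᶠ z in 𝓝 z₀, IsLocalDiffeomorphAt 𝓘(ℝ, C2) 𝓘(ℝ, C2) ∞ q z) :
    ContDiffAt ℝ ∞ (pullEnd q J) z₀ := by
  have hq₀ := hq.self_of_nhds
  have hsmooth : ContMDiffAt 𝓘(ℝ, C2) 𝓘(ℝ, C2) ∞ q z₀ := hq₀.contMDiffAt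
  have hbase : ∀ᶠ z in 𝓝 z₀,
      q z ∈ (trivializationAt C2 (TangentSpace 𝓘(ℝ, C2) (M := Y)) (q z₀)).baseSet :=
    hsmooth.continuousAt.preimage_mem_nhds ((trivializationAt C2 (TangentSpace 𝓘(ℝ, C2) (M := Y))
      (q z₀)).open_baseSet.mem_nhds (FiberBundle.mem_baseSet_trivializationAt' _))
  have hD : ContDiffAt ℝ ∞ (derivInCoordinates q z₀) z₀ :=
    (hsmooth.mfderiv_const (m := ∞) (by simp)).contDiffAt
  have hJq : ContDiffAt ℝ ∞ (endInCoordinates q J z₀) z₀ :=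
    (((contMDiffAt_hom_bundle _).1 (hJ (q z₀))).2.comp z₀ hsmooth).contDiffAt
  have hinv : (derivInCoordinates q z₀ z₀).IsInvertible := by
    rw [derivInCoordinates_eq hbase.self_of_nhds]
    exact ContinuousLinearMap.isInvertible_equiv.comp
      ⟨hq₀.mfderivToContinuousLinearEquiv (by simp), rfl⟩
  refine ((hinv.contDiffAt_map_inverse.comp z₀ hD).clm_comp
    (hJq.clm_comp hD)).congr_of_eventuallyEq ?_
  filter_upwards [hbase, hq] with z hz hqz using pullEnd_eq_inCoordinates J hqz hz

theorem smoothAtInfinity_pullEnd {k : ℕ} {S : Hyperkahler Y} (Φ : ALEEnd k S) (j : Fin 3) :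
    SmoothAtInfinity (pullEnd Φ.q (S.cs j)) := by
  filter_upwards [tendsto_norm_cobounded_atTop.eventually_gt_atTop Φ.ρ] with z hz
  refine contDiffAt_pullEnd (S.cs_smooth j) ?_
  filter_upwards [(isOpen_lt continuous_const continuous_norm).mem_nhds hz] with w hw
  exact Φ.localDiffeo ⟨w, hw⟩

end PullEnd

/-! ### Perturbations of the complex structure -/

theorem norm_mul_inv_norm_pow_isBigO_invR (hm : 0 < m) :
    (fun z : C2 => ‖z‖ * ((‖z‖ ^ 4)⁻¹ * ‖z‖)) =O[cobounded C2] invR m := by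
  refine .of_bound 1 ?_
  filter_upwards [eventually_ne_zero] with z hz
  have hz' : ‖z‖ ≠ 0 := norm_ne_zero_iff.2 hz
  have hR := R_pos hm hz
  have hle : (‖z‖ ^ 2)⁻¹ ≤ (R m z)⁻¹ := inv_anti₀ hR (by linarith [two_mul_R_le_norm_sq hm z])
  rw [show ‖z‖ * ((‖z‖ ^ 4)⁻¹ * ‖z‖) = (‖z‖ ^ 2)⁻¹ by field_simp, one_mul, invR,
    Real.norm_of_nonneg (by positivity), Real.norm_of_nonneg (by positivity)]
  exact hle

section Perturbation

variable {A J : C2 → C2 →L[ℝ] C2}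

theorem isSymbol_coframe_comp (hm : 0 < m) (hs : SmoothAtInfinity A)
    (hA : ∀ l : ℕ, (fun z => ‖iteratedFDeriv ℝ l A z‖) =O[cobounded C2]
      fun z => (‖z‖ ^ (4 + l))⁻¹) (a b : Fin 4) :
    IsSymbol (frame m) (invR m) n fun z => coframe m b z (A z (frame m a z)) := by
  have hAe := (IsSymbol.of_iteratedFDeriv (n := n) (fun b n => isSymbol_frame hm b) hs hA).bilin
    (ContinuousLinearMap.id ℝ (C2 →L[ℝ] C2)) (isSymbol_frame hm a)
  have hα := ((isSymbol_id_horiz hm n).2.bilin symp hAe).const_mul Complex.I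
  have hβ := ((isSymbol_frame hm 0).bilin symp hAe).const_mul (-Complex.I)
  refine IsSymbol.weight ?_ (norm_mul_inv_norm_pow_isBigO_invR hm)
  fin_cases b
  exacts [hα.clm_comp Complex.reCLM, hα.clm_comp Complex.imCLM, hβ.clm_comp Complex.reCLM,
    hβ.clm_comp Complex.imCLM]

theorem isSymbol_fderiv_psiC_comp (hm : 0 < m) (hs : SmoothAtInfinity A)
    (hA : ∀ l : ℕ, (fun z => ‖iteratedFDeriv ℝ l A z‖) =O[cobounded C2]
      fun z => (‖z‖ ^ (4 + l))⁻¹) (a : Fin 4) :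
    IsSymbol (frame m) (fun z => invR m z * invR m z) n
      fun z => fderiv ℝ (psiC m) z (A z (frame m a z)) := by
  refine (IsSymbol.sum Finset.univ fun b _ => (isSymbol_coframe_comp hm hs hA a b).smul
    ((isSymbol_psiC hm).frameDeriv b)).congr ?_
  filter_upwards [(isSymbolicFrame_metric hm).eventually_isDiagonalFrameAt] with z hz
  exact (hz.map_eq_sum (fderiv ℝ (psiC m) z) _).symm

theorem isSymbol_hessianPrimitive (hm : 0 < m) (hs : SmoothAtInfinity J)
    (hJ : ∀ l : ℕ, (fun z => ‖iteratedFDeriv ℝ l (fun w => J w - stdI 0) z‖) =O[cobounded C2]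
      fun z => (‖z‖ ^ (4 + l))⁻¹) (a : Fin 4) :
    IsSymbol (frame m) (fun z => invR m z * invR m z) n
      fun z => hessianPrimitive J (psiC m) z (frame m a z) := by
  have hsub : SmoothAtInfinity fun w => J w - stdI 0 :=
    hs.mono fun _ hz => hz.sub contDiffAt_const
  refine ((isSymbol_hessianPrimitive_psiC hm a).sub
    (isSymbol_fderiv_psiC_comp hm hsub hJ a)).congr (.of_forall fun z => ?_)
  simp only [hessianPrimitive_apply, sub_apply, map_sub]
  ring

theorem isTensorSymbol_ddc_sub_thetaC (hm : 0 < m) (hs : SmoothAtInfinity J)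
    (hJ : ∀ l : ℕ, (fun z => ‖iteratedFDeriv ℝ l (fun w => J w - stdI 0) z‖) =O[cobounded C2]
      fun z => (‖z‖ ^ (4 + l))⁻¹) :
    IsTensorSymbol (frame m) (coframe m) (fun z => invR m z * invR m z) n
      (ddc J (psiC m) - thetaC) := by
  refine ((isSymbolicFrame_metric hm).isTensorSymbol_dOneForm
    (isSymbol_hessianPrimitive hm hs hJ)).congr ?_
  filter_upwards [eventually_ne_zero, (isSymbol_psiC (n := 0) hm).smooth, hs.differentiableAt]
    with z hz hψ hJz
  exact funext fun Z => (ddc_sub_thetaC_eq hz hψ hJz Z).symm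

end Perturbation

end TaubNUT

end

open TaubNUT Asymptotics Bornology in
theorem lemma1p8_general (m : ℝ) (hm : 0 < m) :
    (∀ ℓ, tensorNorm (metric m) (iterCovDeriv (metric m) ℓ (scalar (psiC m)))
      =O[cobounded C2] fun z => (R m z)⁻¹) ∧
    ∀ J : C2 → C2 →L[ℝ] C2, SmoothAtInfinity J →
      (∀ l : ℕ, (fun z => ‖iteratedFDeriv ℝ l (fun w => J w - stdI 0) z‖) =O[cobounded C2]
        fun z => (‖z‖ ^ (4 + l))⁻¹) →
      ∀ ℓ, tensorNorm (metric m) (iterCovDeriv (metric m) ℓ (ddc J (psiC m) - thetaC))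
        =O[cobounded C2] fun z => (R m z ^ 2)⁻¹ := by
  refine ⟨fun ℓ => (isSymbolicFrame_metric hm).tensorNorm_iterCovDeriv_isBigO ℓ
    (.scalar (isSymbol_psiC hm)), fun J hs hJ ℓ => ?_⟩
  refine ((isSymbolicFrame_metric hm).tensorNorm_iterCovDeriv_isBigO ℓ
    (isTensorSymbol_ddc_sub_thetaC hm hs hJ)).congr_right fun z => ?_
  rw [invR, sq, mul_inv]

open TaubNUT Asymptotics in
theorem lemma1p8 (m : ℝ) (hm : 0 < m) :
    (∀ ℓ ≤ 4,
      (tensorNorm (metric m) (iterCovDeriv (metric m) ℓ (scalar (psiC m))))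
        =O[Bornology.cobounded C2] fun z => (R m z)⁻¹) ∧
    (∀ ℓ ≤ 2,
      (tensorNorm (metric m) (iterCovDeriv (metric m) ℓ
          (ddc (fun _ => stdI 0) (psiC m) - thetaC)))
        =O[Bornology.cobounded C2] fun z => (R m z ^ 2)⁻¹) ∧
    (∀ (k : ℕ), 2 ≤ k →
      ∀ (Y : Type*) [TopologicalSpace Y] [T2Space Y] [SecondCountableTopology Y]
        [ConnectedSpace Y] [ChartedSpace C2 Y] [IsManifold 𝓘(ℝ, C2) ∞ Y]
        (S : Hyperkahler Y) (Φ : ALEEnd k S), ∀ ℓ ≤ 2,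
      (tensorNorm (metric m) (iterCovDeriv (metric m) ℓ
          (ddc (pullEnd Φ.q (S.cs 0)) (psiC m) - thetaC)))
        =O[Bornology.cobounded C2] fun z => (R m z ^ 2)⁻¹) := by
  obtain ⟨hψ, hdd⟩ := lemma1p8_general m hm
  refine ⟨fun ℓ _ => hψ ℓ, fun ℓ _ => ?_, fun k _ Y _ _ _ _ _ _ S Φ ℓ _ =>
    hdd _ (smoothAtInfinity_pullEnd Φ 0) (Φ.cs_decay 0) ℓ⟩
  exact hdd _ (.const _) (fun l => by simp [isBigO_zero]) ℓ
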